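/- Let $G$ be a finite simple connected unicyclic graph (a connected graph with exactly one cycle), let $\mathcal C=a_0a_1\dots a_{\ell-1}a_0$ be its cycle, $\ell\ge 3$, and let $T_{a_i}$ be the component of $G-E(\mathcal C)$ containing $a_i$. The distance from a vertex $u$ to an edge $e=v_1v_2$ is $d_G(u,e)=\min\{d_G(u,v_1),d_G(u,v_2)\}$, and a set $S\subseteq V(G)$ is an *edge metric generator* if for any two distinct edges $e,e'$ there is $s\in S$ with $d_G(s,e)\ne d_G(s,e')$. A *thread* attached to a vertex $v$ of degree at least $3$ is a path $v_1\dots v_k$, $k\ge1$, with $vv_1\in E(G)$, with $v_k$ of degree $1$ and with $v_1,\dots,v_{k-1}$ of degree $2$; let $\mathcal S(v)$ be the set of threads attached to $v$. A set $S\subseteq V(G)$ is *branch-resolving* if, for every vertex $v$ of degree at least $3$, at least $|\mathcal S(v)|-1$ of the threads in $\mathcal S(v)$ contain a vertex of $S$. Let $\mathcal B(G)$ be the family of branch-resolving sets of minimum cardinality that consist of vertices of degree $1$. A vertex $v$ is *branching* if $v\in V(\mathcal C)$ and $d_G(v)\ge4$, or $v\notin V(\mathcal C)$ and $d_G(v)\ge3$.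 A vertex of $\mathcal C$ of degree at least $4$ to which a thread is attached is *bad*. For $S\subseteq V(G)$, the vertex $a_i$ is *$S$-active* if $T_{a_i}$ contains a vertex of $S$; $\mathcal A(S)$ is the set of $S$-active vertices. Three distinct vertices $x,y,z$ of $\mathcal C$ form a *geodesic triple* if $d_G(x,y)+d_G(y,z)+d_G(z,x)=\ell$. The labelling of $\mathcal C$ is *normal* with respect to $S$ if $a_0\in\mathcal A(S)$ and the largest index $i\in[0,\ell-1]$ with $a_i\in\mathcal A(S)$ is as small as possible among all labellings of $\mathcal C$ (by rotation and reflection) with $a_0\in\mathcal A(S)$. For a labelling of $\mathcal C$ and an integer $j$ with $1\le j\le\lfloor\frac{\ell-1}2\rfloor$, consider the conditions (i) neither $a_0$ nor $a_j$ is a bad vertex; (ii) if $j<\lfloor\frac{\ell-1}2\rfloor$, then $V(T_{a_k})=\{a_k\}$ for every $k\in\{\ell-1,\dots,\ell-(\lfloor\frac{\ell-1}2\rfloor-j)\}\cup\{j+1,\dots,j+(\lfloor\frac{\ell-1}2\rfloor-j)\}$; (iii) if $j>1$ and no $T_{a_k}$ with $k\in[1,j-1]$ contains a branching vertex, then for every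 $k\in[1,j-1]$ the path $T_{a_k}$ has length (number of edges) at most $\frac{\ell-1}2-j$; (iv) if $j>1$ and for every $k\in[1,j-1]$ neither $T_{a_k}$ nor $T_{a_{k'}}$, where $k'=\frac\ell2+j-k$, contains a branching vertex, then for every $k\in[1,j-1]$ with $|V(T_{a_{k'}})|>1$ the path $T_{a_k}$ has length at most $\frac\ell2-j$. $G$ (so labelled) is an *edge-odd-$(\ell,j)$ graph* if $1\le j\le\lfloor\frac{\ell-1}2\rfloor$, $\ell$ is odd and (i), (ii), (iii) hold, and an *edge-even-$(\ell,j)$ graph* if $1\le j\le\lfloor\frac{\ell-1}2\rfloor$, $\ell$ is even and (i), (ii), (iv) hold. **Theorem 2.** Let $G$ be a unicyclic graph and $S\in\mathcal B(G)$ with $|\mathcal A(S)|\ge2$. Label $\mathcal C$ normally with respect to $S$ and let $j=\max\{i\in[0,\ell-1]: a_i\in\mathcal A(S)\}$. Then $S$ is an edge metric generator of $G$ if and only if there are three $S$-active vertices forming a geodesic triple, or $G$ is an edge-odd-$(\ell,j)$ graph, or $G$ is an edge-even-$(\ell,j)$ graph. -/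

import Mathlib

/-- `G` is unicyclic: it is connected and has exactly one cycle (as a subgraph, i.e. any two closed
walks that are cycles have the same edges). -/
def IsUnicyclic {V : Type*} (G : SimpleGraph V) : Prop :=
  G.Connected ∧ (∃ (v : V) (c : G.Walk v v), c.IsCycle) ∧
    ∀ (u v : V) (c : G.Walk u u) (d : G.Walk v v), c.IsCycle → d.IsCycle →
      ∀ e : Sym2 V, e ∈ c.edges ↔ e ∈ d.edges

/-- The edges of the cycle `C` of a unicyclic graph. -/
def cycleEdges {V : Type*} (G : SimpleGraph V) : Set (Sym2 V) :=
  {e | ∃ (v : V) (c : G.Walk v v), c.IsCycle ∧ e ∈ c.edges}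

/-- The vertices of the cycle `C` of a unicyclic graph. -/
def cycleVertices {V : Type*} (G : SimpleGraph V) : Set V :=
  {w | ∃ (v : V) (c : G.Walk v v), c.IsCycle ∧ w ∈ c.support}

/-- A labelling `C = a₀ a₁ … a_{ℓ-1} a₀` of the cycle of a unicyclic graph `G`. The labelling is
extended to all natural indices by `a_{i+ℓ} = a_i`. In a unicyclic graph, such a sequence
runs once around the unique cycle, so `ℓ` is the length of that cycle. -/
def IsCycleLabelling {V : Type*} (G : SimpleGraph V) (ℓ : ℕ) (a : ℕ → V) : Prop :=
  3 ≤ ℓ ∧ (∀ i, G.Adj (a i) (a (i + 1))) ∧ (∀ i, a (i + ℓ) = a i) ∧ Set.InjOn a (Set.Iio ℓ)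

/-- The vertex set of `T_v`, the component of `G - E(C)` containing `v`. -/
def attachedTree {V : Type*} (G : SimpleGraph V) (v : V) : Set V :=
  {w | (G.deleteEdges (cycleEdges G)).Reachable v w}

/-- The number of edges of `T_v`; this is its length when `T_v` is a path. -/
noncomputable def attachedTreeLength {V : Type*} (G : SimpleGraph V) (v : V) : ℕ :=
  (attachedTree G v).ncard - 1

/-- The set `A(S)` of `S`-active vertices: the cycle vertices `v` such that `T_v` meets `S`. -/
def activeVertices {V : Type*} (G : SimpleGraph V) (S : Finset V) : Set V :=
  {v | v ∈ cycleVertices G ∧ ∃ s ∈ S, s ∈ attachedTree G v}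

/-- Branching vertices. -/
def IsBranchingVertex {V : Type*} [Fintype V] (G : SimpleGraph V) [DecidableRel G.Adj]
    (v : V) : Prop :=
  (v ∈ cycleVertices G ∧ 4 ≤ G.degree v) ∨ (v ∉ cycleVertices G ∧ 3 ≤ G.degree v)

/-- The set of threads attached to `v` (used for vertices `v` of degree at least 3): paths
`v₁ … v_k`, `k ≥ 1`, with `v v₁` an edge, `v_k` of degree 1 and all other `v_i` of degree 2. -/
def threads {V : Type*} [Fintype V] (G : SimpleGraph V) [DecidableRel G.Adj]
    (v : V) : Set (List V) :=
  {p | p.Nodup ∧ List.IsChain G.Adj (v :: p) ∧ (∀ w ∈ p.dropLast, G.degree w = 2) ∧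
    ∃ h : p ≠ [], G.degree (p.getLast h) = 1}

/-- Bad vertices: cycle vertices of degree at least 4 with a thread attached. -/
def IsBadVertex {V : Type*} [Fintype V] (G : SimpleGraph V) [DecidableRel G.Adj]
    (v : V) : Prop :=
  v ∈ cycleVertices G ∧ 4 ≤ G.degree v ∧ (threads G v).Nonempty

/-- `S` is branch-resolving: for each vertex `v` of degree at least 3, at least
`(number of threads attached to v) - 1` of the threads attached to `v` contain a vertex of `S`. -/
def IsBranchResolving {V : Type*} [Fintype V] (G : SimpleGraph V) [DecidableRel G.Adj]
    (S : Finset V) : Prop :=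
  ∀ v : V, 3 ≤ G.degree v →
    (threads G v).ncard ≤ {p ∈ threads G v | ∃ s ∈ S, s ∈ p}.ncard + 1

/-- The family `B(G)`: the branch-resolving sets of minimum cardinality that consist of vertices
of degree 1. -/
def minBranchResolvingSets {V : Type*} [Fintype V] (G : SimpleGraph V) [DecidableRel G.Adj] :
    Set (Finset V) :=
  {S | IsBranchResolving G S ∧ (∀ S' : Finset V, IsBranchResolving G S' → S.card ≤ S'.card) ∧
    ∀ s ∈ S, G.degree s = 1}

/-- `j` is the largest index in `[0, ℓ-1]` such that `a_j` is `S`-active. -/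
def IsLastActiveIndex {V : Type*} (G : SimpleGraph V) (S : Finset V) (ℓ : ℕ) (a : ℕ → V)
    (j : ℕ) : Prop :=
  IsGreatest {i | i < ℓ ∧ a i ∈ activeVertices G S} j

/-- A normal labelling with respect to `S`: `a₀` is `S`-active, and the largest index of an
`S`-active vertex is smallest possible among the labellings whose vertex `a₀` is `S`-active. -/
def IsNormalLabelling {V : Type*} (G : SimpleGraph V) (S : Finset V) (ℓ : ℕ) (a : ℕ → V) : Prop :=
  IsCycleLabelling G ℓ a ∧ a 0 ∈ activeVertices G S ∧
    ∀ b : ℕ → V, IsCycleLabelling G ℓ b → b 0 ∈ activeVertices G S →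
      ∀ j j' : ℕ, IsLastActiveIndex G S ℓ a j → IsLastActiveIndex G S ℓ b j' → j ≤ j'

/-- The distance from a vertex to an edge: the distance to the nearer endpoint. -/
noncomputable def vertexEdgeDist {V : Type*} (G : SimpleGraph V) (u : V) (e : Sym2 V) : ℕ :=
  Sym2.lift ⟨fun x y => min (G.dist u x) (G.dist u y), fun _ _ => min_comm _ _⟩ e

/-- `S` is an edge metric generator of `G`: it distinguishes every pair of edges. -/
def IsEdgeMetricGenerator {V : Type*} (G : SimpleGraph V) (S : Finset V) : Prop :=
  ∀ e ∈ G.edgeSet, ∀ f ∈ G.edgeSet, e ≠ f →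
    ∃ s ∈ S, vertexEdgeDist G s e ≠ vertexEdgeDist G s f

/-- Three (distinct) vertices of the cycle, of length `ℓ`, forming a geodesic triple. -/
def IsGeodesicTriple {V : Type*} (G : SimpleGraph V) (ℓ : ℕ) (x y z : V) : Prop :=
  x ∈ cycleVertices G ∧ y ∈ cycleVertices G ∧ z ∈ cycleVertices G ∧
    x ≠ y ∧ y ≠ z ∧ x ≠ z ∧ G.dist x y + G.dist y z + G.dist z x = ℓ

/-- The requirements common to edge-odd-`(ℓ, j)` and edge-even-`(ℓ, j)` graphs: the range of `j`,
neither `a₀` nor `a_j` is bad, and `T_{a_k}` is trivial for the `⌊(ℓ-1)/2⌋ - j` indices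
following `j` and for the last `⌊(ℓ-1)/2⌋ - j` indices. -/
def EdgeCommonConditions {V : Type*} [Fintype V] (G : SimpleGraph V) [DecidableRel G.Adj]
    (ℓ : ℕ) (a : ℕ → V) (j : ℕ) : Prop :=
  1 ≤ j ∧ j ≤ (ℓ - 1) / 2 ∧
  (¬ IsBadVertex G (a 0) ∧ ¬ IsBadVertex G (a j)) ∧
  (j < (ℓ - 1) / 2 → ∀ k : ℕ,
    (ℓ - ((ℓ - 1) / 2 - j) ≤ k ∧ k ≤ ℓ - 1) ∨ (j + 1 ≤ k ∧ k ≤ j + ((ℓ - 1) / 2 - j)) →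
      attachedTree G (a k) = {a k})

/-- `G`, with its cycle labelled by `a`, is an edge-odd-`(ℓ, j)` graph. -/
def IsEdgeOddGraph {V : Type*} [Fintype V] (G : SimpleGraph V) [DecidableRel G.Adj]
    (ℓ : ℕ) (a : ℕ → V) (j : ℕ) : Prop :=
  Odd ℓ ∧ EdgeCommonConditions G ℓ a j ∧
  (1 < j → (∀ k, 1 ≤ k → k ≤ j - 1 → ∀ w ∈ attachedTree G (a k), ¬ IsBranchingVertex G w) →
    ∀ k, 1 ≤ k → k ≤ j - 1 → attachedTreeLength G (a k) ≤ (ℓ - 1) / 2 - j)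

/-- `G`, with its cycle labelled by `a`, is an edge-even-`(ℓ, j)` graph. -/
def IsEdgeEvenGraph {V : Type*} [Fintype V] (G : SimpleGraph V) [DecidableRel G.Adj]
    (ℓ : ℕ) (a : ℕ → V) (j : ℕ) : Prop :=
  Even ℓ ∧ EdgeCommonConditions G ℓ a j ∧
  (1 < j →
    (∀ k, 1 ≤ k → k ≤ j - 1 →
      (∀ w ∈ attachedTree G (a k), ¬ IsBranchingVertex G w) ∧
      (∀ w ∈ attachedTree G (a (ℓ / 2 + j - k)), ¬ IsBranchingVertex G w)) →
    ∀ k, 1 ≤ k → k ≤ j - 1 → 1 < (attachedTree G (a (ℓ / 2 + j - k))).ncard →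
      attachedTreeLength G (a k) ≤ ℓ / 2 - j)

/-! Each vertex is described by the index of its tree and its depth there. Subdividing the cycle
edges puts `a i` at position `2 i` on a cycle of length `2 ℓ`. A cycle edge gets an odd position and
weight `0`; a tree edge with lower endpoint of depth `d` gets the position of its root and weight `2
d - 1`. For an edge `e` at position `x` of weight `W`, `2 d(s, e) + 1 = 2 depth s + cycDist (2 ℓ) (2
root s) x + W` when `s` lies at another position, and `≤` always (`HasPosition.vertexEdgeDist_eq`,
`HasPosition.vertexEdgeDist_le`). Most of the theorem thus becomes arithmetic on a cycle with
weights.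

Edges at one position are always separated: a vertex of `S` in another tree reads off the depth, and
two tree edges of equal depth lie below siblings, one of which has a vertex of `S` below it. For
different positions, a geodesic triple of active vertices determines the position
(`eq_of_cycDist_triple`).

Without a triple, normality forces `2 j ≤ ℓ`, and `2 j = ℓ` fails because the two cycle edges at `a
0` are confounded. Conditions (i) and (ii) remove the confusions at the ends and outside the active
arc and its antipode. What the observers at `0` and `2 j` can then still confuse are mirror
positions `x + y = ℓ + 2 j` with `x < 2 j` and weights differing by `ℓ - 2 j` (`cycDist_pair`), and
any active vertex strictly between them separates these (`cycDist_lt_of_between`). As `x` carries a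
tree edge, `y` has the parity of `ℓ`: the partner is a cycle edge for odd `ℓ`, whence (iii), and a
tree edge for even `ℓ`, whence (iv).

Minimality of `S` translates the combinatorial hypotheses: a tree contains a branching vertex
exactly when it meets `S` (`exists_desc_of_two_le_card`, `exists_two_le_card_children`), and an
active cycle vertex is bad exactly when some branch at it misses `S` (`exists_child_of_isBadVertex`,
`exists_desc_of_not_isBadVertex`). -/

open SimpleGraph

/-! ### The labelled cycle and the components left by deleting its edges. -/

namespace IsCycleLabelling

variable {V : Type*} {G : SimpleGraph V} {ℓ : ℕ} {a : ℕ → V}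

theorem apply_mod (ha : IsCycleLabelling G ℓ a) (i : ℕ) : a (i % ℓ) = a i :=
  Function.Periodic.map_mod_nat ha.2.2.1 i

theorem pos (ha : IsCycleLabelling G ℓ a) : 0 < ℓ := by have := ha.1; omega

theorem apply_eq_iff (ha : IsCycleLabelling G ℓ a) (i k : ℕ) : a i = a k ↔ i % ℓ = k % ℓ := by
  constructor
  · intro h
    rw [← ha.apply_mod i, ← ha.apply_mod k] at h
    exact ha.2.2.2 (Nat.mod_lt _ ha.pos) (Nat.mod_lt _ ha.pos) h
  · intro h
    rw [← ha.apply_mod i, ← ha.apply_mod k, h]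

theorem eq_of_lt (ha : IsCycleLabelling G ℓ a) {i k : ℕ} (hi : i < ℓ) (hk : k < ℓ)
    (h : a i = a k) : i = k := ha.2.2.2 hi hk h

theorem edge_injective (ha : IsCycleLabelling G ℓ a) {i k : ℕ} (hi : i < ℓ) (hk : k < ℓ)
    (h : s(a i, a (i + 1)) = s(a k, a (k + 1))) : i = k := by
  have h3 := ha.1
  rw [Sym2.eq_iff] at h
  rcases h with ⟨h, -⟩ | ⟨h1, h2⟩
  · exact ha.eq_of_lt hi hk h
  · rw [ha.apply_eq_iff, Nat.mod_eq_of_lt hi] at h1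
    rw [ha.apply_eq_iff, Nat.mod_eq_of_lt hk] at h2
    rcases Nat.lt_or_ge (i + 1) ℓ with h4 | h4 <;> rcases Nat.lt_or_ge (k + 1) ℓ with h5 | h5
    · rw [Nat.mod_eq_of_lt h5] at h1; rw [Nat.mod_eq_of_lt h4] at h2; omega
    · obtain rfl : ℓ = k + 1 := by omega
      rw [Nat.mod_self] at h1; rw [Nat.mod_eq_of_lt h4] at h2; omega
    · obtain rfl : ℓ = i + 1 := by omega
      rw [Nat.mod_self] at h2; rw [Nat.mod_eq_of_lt h5] at h1; omega
    · omega

/-- The arc `a₀ a₁ … aₙ`. -/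
def arc (ha : IsCycleLabelling G ℓ a) : ∀ n : ℕ, G.Walk (a 0) (a n)
  | 0 => Walk.nil
  | n + 1 => (ha.arc n).concat (ha.2.1 n)

theorem mem_support_arc (ha : IsCycleLabelling G ℓ a) (n : ℕ) (v : V) :
    v ∈ (ha.arc n).support ↔ ∃ i ≤ n, v = a i := by
  induction n with
  | zero => simp [arc]
  | succ n ih =>
    simp only [arc, Walk.support_concat, List.mem_append, ih, List.mem_singleton]
    constructor
    · rintro (⟨i, hi, rfl⟩ | rfl)
      exacts [⟨i, by omega, rfl⟩, ⟨n + 1, le_rfl, rfl⟩]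
    · rintro ⟨i, hi, rfl⟩
      rcases Nat.lt_or_ge n i with h | h
      · right; congr 1; omega
      · left; exact ⟨i, h, rfl⟩

theorem mem_edges_arc (ha : IsCycleLabelling G ℓ a) (n : ℕ) (e : Sym2 V) :
    e ∈ (ha.arc n).edges ↔ ∃ i < n, e = s(a i, a (i + 1)) := by
  induction n with
  | zero => simp [arc]
  | succ n ih =>
    simp only [arc, Walk.edges_concat, List.concat_eq_append, List.mem_append, ih,
      List.mem_singleton]
    constructor
    · rintro (⟨i, hi, rfl⟩ | rfl)
      exacts [⟨i, by omega, rfl⟩, ⟨n, by omega, rfl⟩]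
    · rintro ⟨i, hi, rfl⟩
      rcases Nat.lt_or_ge i n with h | h
      · left; exact ⟨i, h, rfl⟩
      · right; obtain rfl : i = n := by omega
        rfl

theorem isPath_arc (ha : IsCycleLabelling G ℓ a) {n : ℕ} (hn : n < ℓ) : (ha.arc n).IsPath := by
  induction n with
  | zero => simp [arc]
  | succ n ih =>
    rw [arc, Walk.concat_isPath_iff]
    refine ⟨ih (by omega), fun h => ?_⟩
    obtain ⟨i, hi, h⟩ := (ha.mem_support_arc _ _).1 h
    have := ha.eq_of_lt hn (by omega) h
    omega

theorem exists_isCycle (ha : IsCycleLabelling G ℓ a) : ∃ (v : V) (c : G.Walk v v), c.IsCycle ∧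
    ∀ e, e ∈ c.edges ↔ ∃ i < ℓ, e = s(a i, a (i + 1)) := by
  obtain ⟨n, rfl⟩ : ∃ n, ℓ = n + 1 := ⟨ℓ - 1, by have := ha.pos; omega⟩
  have h3 := ha.1
  have h0 : a (n + 1) = a 0 := by simpa using ha.2.2.1 0
  have hadj : G.Adj (a n) (a 0) := h0 ▸ ha.2.1 n
  refine ⟨a n, Walk.cons hadj (ha.arc n), ?_, ?_⟩
  · rw [Walk.cons_isCycle_iff]
    refine ⟨ha.isPath_arc (by omega), fun h => ?_⟩
    obtain ⟨i, hi, h⟩ := (ha.mem_edges_arc _ _).1 h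
    rw [← h0] at h
    have := ha.edge_injective (by omega) (by omega) h
    omega
  · intro e
    rw [Walk.edges_cons, List.mem_cons, ha.mem_edges_arc]
    constructor
    · rintro (rfl | ⟨i, hi, rfl⟩)
      exacts [⟨n, by omega, by rw [h0]⟩, ⟨i, by omega, rfl⟩]
    · rintro ⟨i, hi, rfl⟩
      rcases Nat.lt_or_ge i n with h | h
      · right; exact ⟨i, h, rfl⟩
      · left; obtain rfl : i = n := by omega
        rw [h0]

theorem mem_cycleEdges (ha : IsCycleLabelling G ℓ a) (hG : IsUnicyclic G) (e : Sym2 V) :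
    e ∈ cycleEdges G ↔ ∃ i < ℓ, e = s(a i, a (i + 1)) := by
  obtain ⟨v, c, hc, hce⟩ := ha.exists_isCycle
  rw [← hce]
  constructor
  · rintro ⟨w, d, hd, hde⟩
    exact (hG.2.2 _ _ d c hd hc e).1 hde
  · intro h
    exact ⟨v, c, hc, h⟩

theorem mem_cycleVertices (ha : IsCycleLabelling G ℓ a) (hG : IsUnicyclic G) (v : V) :
    v ∈ cycleVertices G ↔ ∃ i < ℓ, v = a i := by
  obtain ⟨w, c, hc, hce⟩ := ha.exists_isCycle
  constructor
  · rintro ⟨u, d, hd, hv⟩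
    rw [Walk.mem_support_iff_exists_mem_edges_of_not_nil hd.not_nil] at hv
    obtain ⟨e, he, hve⟩ := hv
    obtain ⟨i, hi, rfl⟩ := (ha.mem_cycleEdges hG e).1 ⟨u, d, hd, he⟩
    rcases Sym2.mem_iff.1 hve with rfl | rfl
    · exact ⟨i, hi, rfl⟩
    · exact ⟨(i + 1) % ℓ, Nat.mod_lt _ ha.pos, (ha.apply_mod _).symm⟩
  · rintro ⟨i, hi, rfl⟩
    exact ⟨w, c, hc, Walk.fst_mem_support_of_mem_edges c ((hce _).2 ⟨i, hi, rfl⟩)⟩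

/-- A connection off the cycle together with the arc from `a (i + 1)` to `a k` would put `s(a i, a
(i + 1))` on a cycle avoiding the closing edge `e₀`, while every cycle of a unicyclic graph uses
`e₀`. -/
theorem not_reachable_deleteEdges (ha : IsCycleLabelling G ℓ a) (hG : IsUnicyclic G) {i k : ℕ}
    (hik : i < k) (hk : k < ℓ) : ¬ (G.deleteEdges (cycleEdges G)).Reachable (a i) (a k) := by
  intro hr
  set e₀ : Sym2 V := s(a (ℓ - 1), a (ℓ - 1 + 1)) with he₀
  set H := G.deleteEdges {e₀} with hH
  have harc : ∀ n, i + 1 + n ≤ k →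
      (H.deleteEdges {s(a i, a (i + 1))}).Reachable (a (i + 1)) (a (i + 1 + n)) := by
    intro n
    induction n with
    | zero => intro _; exact Reachable.refl _
    | succ n ih =>
      intro hn
      refine (ih (by omega)).trans (Adj.reachable ?_)
      rw [deleteEdges_adj, hH, deleteEdges_adj]
      refine ⟨⟨ha.2.1 _, fun h => ?_⟩, fun h => ?_⟩
      · have := ha.edge_injective (by omega) (by omega) h
        omega
      · have := ha.edge_injective (by omega) (by omega) h
        omega
  have hle : G.deleteEdges (cycleEdges G) ≤ H.deleteEdges {s(a i, a (i + 1))} := by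
    intro x y hxy
    rw [deleteEdges_adj, ha.mem_cycleEdges hG] at hxy
    rw [deleteEdges_adj, hH, deleteEdges_adj]
    refine ⟨⟨hxy.1, fun h => hxy.2 ⟨ℓ - 1, by omega, h⟩⟩, fun h => hxy.2 ⟨i, by omega, h⟩⟩
  have h1 := harc (k - (i + 1)) (by omega)
  rw [show i + 1 + (k - (i + 1)) = k by omega] at h1
  have h2 := (hr.mono hle).trans h1.symm
  have hadj : H.Adj (a i) (a (i + 1)) := by
    rw [hH, deleteEdges_adj]
    refine ⟨ha.2.1 _, fun h => ?_⟩
    have := ha.edge_injective (by omega) (by omega) h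
    omega
  obtain ⟨u, p, hp, -⟩ := adj_and_reachable_delete_edges_iff_exists_cycle.1 ⟨hadj, h2⟩
  have hHG : H ≤ G := deleteEdges_le _
  have hp' := hp.mapLe hHG
  have h3 : e₀ ∈ (p.mapLe hHG).edges := by
    obtain ⟨v, c, hc, hce⟩ := ha.exists_isCycle
    exact (hG.2.2 _ _ c _ hc hp' e₀).1 ((hce _).2 ⟨ℓ - 1, by omega, rfl⟩)
  rw [Walk.edges_mapLe_eq_edges] at h3
  have := p.edges_subset_edgeSet h3
  rw [hH, edgeSet_deleteEdges] at this
  exact this.2 rfl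

end IsCycleLabelling

theorem isAcyclic_deleteEdges_cycleEdges {V : Type*} (G : SimpleGraph V) :
    (G.deleteEdges (cycleEdges G)).IsAcyclic := by
  intro v c hc
  have hle : G.deleteEdges (cycleEdges G) ≤ G := deleteEdges_le _
  obtain ⟨e, he⟩ : ∃ e, e ∈ c.edges := by
    cases c with
    | nil => exact absurd rfl hc.ne_nil
    | cons h p => exact ⟨_, by rw [Walk.edges_cons]; exact List.mem_cons_self⟩
  have h1 : e ∈ cycleEdges G :=
    ⟨v, c.mapLe hle, hc.mapLe hle, by rwa [Walk.edges_mapLe_eq_edges]⟩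
  have := c.edges_subset_edgeSet he
  rw [edgeSet_deleteEdges] at this
  exact this.2 h1

/-! ### Rooted trees hanging from the cycle, and their coordinates. -/

namespace SimpleGraph

variable {V : Type*} {F : SimpleGraph V} {r : V}

theorem Reachable.exists_adj_dist_add_one {x : V} (h : F.Reachable r x) (hx : x ≠ r) :
    ∃ u, F.Adj u x ∧ F.Reachable r u ∧ F.dist r u + 1 = F.dist r x := by
  obtain ⟨p, hp⟩ := h.exists_walk_length_eq_dist
  rcases eq_or_ne p.length 0 with h0 | h0
  · exact absurd (Walk.eq_of_length_eq_zero h0).symm hx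
  · obtain ⟨u, q, hu, rfl⟩ : ∃ (u : V) (q : F.Walk r u) (hu : F.Adj u x), p = q.concat hu := by
      cases p with
      | nil => simp at h0
      | cons h p =>
        obtain ⟨u, q, hu, h⟩ := Walk.exists_cons_eq_concat h p
        exact ⟨u, q, hu, h⟩
    refine ⟨u, hu, q.reachable, ?_⟩
    rw [Walk.length_concat] at hp
    have h1 := dist_le q
    have h2 : F.dist r x ≤ F.dist r u + 1 := by
      have := hu.diff_dist_adj (u := r)
      omega
    omega

/-- A shortest path from `r` to `x` cannot visit a vertex `y ≠ x` that is at least as far away. -/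
theorem Reachable.deleteEdges_of_dist_le {x y : V} (h : F.Reachable r x) (hxy : y ≠ x)
    (hd : F.dist r x ≤ F.dist r y) (z : V) : (F.deleteEdges {s(y, z)}).Reachable r x := by
  induction hn : F.dist r x generalizing x with
  | zero =>
    rw [h.dist_eq_zero_iff] at hn
    rw [hn]
  | succ n ih =>
    have hxr : x ≠ r := by
      rintro rfl
      simp at hn
    obtain ⟨p, hp, hrp, hpd⟩ := h.exists_adj_dist_add_one hxr
    have hyp : y ≠ p := by
      rintro rfl
      omega
    refine (ih hrp hyp (by omega) (by omega)).trans (Adj.reachable ?_)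
    rw [deleteEdges_adj]
    refine ⟨hp, fun h => ?_⟩
    rcases Sym2.mem_iff.1 (h ▸ Sym2.mem_mk_left y z : y ∈ s(p, x)) with h | h
    exacts [hyp h, hxy h]

/-- Uniqueness of parents: with two of them, `v` and `u` stay connected through `u'` and `r` after
deleting the edge `s(v, u)`, which is a bridge in a forest. -/
theorem IsAcyclic.eq_of_adj_of_dist_lt (hF : F.IsAcyclic) {u u' v : V} (h : F.Reachable r v)
    (hu : F.Adj u v) (hu' : F.Adj u' v) (hd : F.dist r u < F.dist r v)
    (hd' : F.dist r u' < F.dist r v) : u = u' := by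
  by_contra hne
  have h1 := (h.trans hu.symm.reachable).deleteEdges_of_dist_le hu.ne.symm hd.le u
  have h2 := (h.trans hu'.symm.reachable).deleteEdges_of_dist_le hu'.ne.symm hd'.le u
  have h3 : (F.deleteEdges {s(v, u)}).Adj u' v := by
    rw [deleteEdges_adj]
    refine ⟨hu', fun h => ?_⟩
    rcases Sym2.mem_iff.1 (h ▸ Sym2.mem_mk_left u' v : u' ∈ s(v, u)) with h | h
    exacts [hu'.ne h, hne h.symm]
  exact (isBridge_iff.1 (isAcyclic_iff_forall_adj_isBridge.1 hF hu.symm))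
    ((h3.symm.reachable.trans h2.symm).trans h1)

end SimpleGraph

/-- Coordinates on a connected graph whose edges are those of the cycle labelled by `a` and those
of rooted trees attached to its vertices: the parent, the index of the root of the tree, and the
depth in the tree of each vertex. -/
structure CycleCoords {V : Type*} (G : SimpleGraph V) (ℓ : ℕ) (a : ℕ → V) where
  par : V → V
  root : V → ℕ
  depth : V → ℕ
  connected : G.Connected
  labelling : IsCycleLabelling G ℓ a
  root_lt : ∀ v, root v < ℓ
  eq_of_depth_eq_zero : ∀ v, depth v = 0 → v = a (root v)
  root_apply : ∀ i < ℓ, root (a i) = i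
  depth_apply : ∀ i, depth (a i) = 0
  depth_par : ∀ v, 0 < depth v → depth (par v) + 1 = depth v
  root_par : ∀ v, 0 < depth v → root (par v) = root v
  adj_par : ∀ v, 0 < depth v → G.Adj (par v) v
  adj_cases : ∀ u v, G.Adj u v → (∃ i < ℓ, s(u, v) = s(a i, a (i + 1))) ∨
    (0 < depth v ∧ u = par v) ∨ (0 < depth u ∧ v = par u)
  mem_cycleVertices : ∀ v, v ∈ cycleVertices G ↔ depth v = 0
  mem_attachedTree : ∀ i < ℓ, ∀ v, v ∈ attachedTree G (a i) ↔ root v = i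

open Classical in
theorem IsCycleLabelling.exists_cycleCoords {V : Type*} {G : SimpleGraph V} {ℓ : ℕ} {a : ℕ → V}
    (ha : IsCycleLabelling G ℓ a) (hG : IsUnicyclic G) : Nonempty (CycleCoords G ℓ a) := by
  set F := G.deleteEdges (cycleEdges G) with hF
  have hac : F.IsAcyclic := isAcyclic_deleteEdges_cycleEdges G
  have hex : ∀ v, ∃ i, i < ℓ ∧ F.Reachable (a i) v := by
    intro v
    obtain ⟨p⟩ := hG.1.preconnected v (a 0)
    generalize hw : a 0 = w at p
    induction p with
    | nil => exact ⟨0, ha.pos, hw ▸ Reachable.refl _⟩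
    | @cons u x y hux p ih =>
      by_cases hc : s(u, x) ∈ cycleEdges G
      · obtain ⟨i, hi, h⟩ := (ha.mem_cycleEdges hG _).1 hc
        have : u = a i ∨ u = a (i + 1) := by
          rw [← Sym2.mem_iff, ← h]
          exact Sym2.mem_mk_left _ _
        rcases this with rfl | rfl
        · exact ⟨i, hi, Reachable.refl _⟩
        · exact ⟨(i + 1) % ℓ, Nat.mod_lt _ ha.pos, by rw [ha.apply_mod]⟩
      · obtain ⟨i, hi, h⟩ := ih hw
        refine ⟨i, hi, h.trans (Adj.reachable ?_)⟩
        rw [hF, deleteEdges_adj]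
        exact ⟨hux.symm, by rwa [Sym2.eq_swap]⟩
  choose root hroot hreach using hex
  have huniq : ∀ i k v, i < ℓ → k < ℓ → F.Reachable (a i) v → F.Reachable (a k) v → i = k := by
    intro i k v hi hk h1 h2
    rcases lt_trichotomy i k with h | h | h
    · exact absurd (h1.trans h2.symm) (ha.not_reachable_deleteEdges hG h hk)
    · exact h
    · exact absurd (h2.trans h1.symm) (ha.not_reachable_deleteEdges hG h hi)
  set depth : V → ℕ := fun v => F.dist (a (root v)) v with hdepth
  have hroot_eq : ∀ u v, F.Adj u v → root u = root v := fun u v h =>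
    huniq _ _ v (hroot u) (hroot v) ((hreach u).trans h.reachable) (hreach v)
  have hroot_a : ∀ i < ℓ, root (a i) = i := fun i hi =>
    huniq _ _ (a i) (hroot _) hi (hreach _) (Reachable.refl _)
  have hpar : ∀ v, ∃ u, 0 < depth v → F.Adj u v ∧ depth u + 1 = depth v := by
    intro v
    by_cases hv : 0 < depth v
    · have : v ≠ a (root v) := by
        intro h
        rw [hdepth] at hv
        simp only at hv
        rw [← h] at hv
        simp at hv
      obtain ⟨u, hu, -, hd⟩ := (hreach v).exists_adj_dist_add_one this
      refine ⟨u, fun _ => ⟨hu, ?_⟩⟩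
      simp only [hdepth]
      rw [hroot_eq u v hu, hd]
    · exact ⟨v, fun h => absurd h hv⟩
  choose par hpar using hpar
  have hFG : ∀ u v, F.Adj u v → G.Adj u v := fun u v h => (deleteEdges_adj.1 h).1
  have hdepth_a : ∀ i, depth (a i) = 0 := by
    intro i
    rw [← ha.apply_mod]
    simp only [hdepth]
    rw [hroot_a _ (Nat.mod_lt _ ha.pos), dist_self]
  have hz : ∀ v, depth v = 0 → v = a (root v) := fun v h =>
    ((hreach v).dist_eq_zero_iff.1 h).symm
  have hlt : ∀ u v, F.Adj u v → depth u < depth v → 0 < depth v ∧ u = par v := by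
    intro u v h hd
    have hv : 0 < depth v := by omega
    obtain ⟨h1, h2⟩ := hpar v hv
    refine ⟨hv, hac.eq_of_adj_of_dist_lt (hreach v) h h1 ?_ ?_⟩
    · have : depth u < depth v := hd
      simp only [hdepth] at this
      rwa [hroot_eq u v h] at this
    · have : depth (par v) < depth v := by omega
      simp only [hdepth] at this
      rwa [hroot_eq _ v h1] at this
  refine ⟨⟨par, root, depth, hG.1, ha, hroot, hz, hroot_a, hdepth_a,
    fun v hv => (hpar v hv).2, fun v hv => hroot_eq _ _ (hpar v hv).1,
    fun v hv => hFG _ _ (hpar v hv).1, ?_, ?_, ?_⟩⟩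
  · intro u v huv
    by_cases hc : s(u, v) ∈ cycleEdges G
    · left
      exact (ha.mem_cycleEdges hG _).1 hc
    · right
      have hFuv : F.Adj u v := by
        rw [hF, deleteEdges_adj]
        exact ⟨huv, hc⟩
      have hne : depth u ≠ depth v := by
        simp only [hdepth]
        rw [← hroot_eq u v hFuv]
        exact hac.dist_ne_of_adj hFuv (hreach u)
      rcases lt_or_gt_of_ne hne with h | h
      · exact Or.inl (hlt u v hFuv h)
      · exact Or.inr (hlt v u hFuv.symm h)
  · intro v
    rw [ha.mem_cycleVertices hG]
    constructor
    · rintro ⟨i, hi, rfl⟩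
      exact hdepth_a i
    · intro h
      exact ⟨root v, hroot v, hz v h⟩
  · intro i hi v
    constructor
    · intro h
      exact huniq _ _ v (hroot v) hi (hreach v) h
    · rintro rfl
      exact hreach v

/-! ### Distances in coordinates. -/

/-- All lower bounds on distances come from this: a potential that rises by at most one along each
edge. -/
theorem SimpleGraph.Connected.le_add_dist_of_adj {V : Type*} {G : SimpleGraph V}
    (hG : G.Connected) (φ : V → ℕ) (hφ : ∀ x y, G.Adj x y → φ y ≤ φ x + 1) (u v : V) :
    φ v ≤ φ u + G.dist u v := by
  obtain ⟨p, hp⟩ := hG.exists_walk_length_eq_dist u v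
  rw [← hp]
  clear hp
  induction p with
  | nil => simp
  | cons h p ih =>
    have := hφ _ _ h
    rw [Walk.length_cons]
    omega

/-- The distance of two positions on a cycle of length `ℓ`. -/
def cycDist (ℓ i k : ℕ) : ℕ := min (max i k - min i k) (ℓ - (max i k - min i k))

/-- The distance from position `r` to the edge between the positions `i` and `i + 1` on a cycle of
length `ℓ`. -/
def cycEdgeDist (ℓ r i : ℕ) : ℕ :=
  if r ≤ i then min (i - r) (ℓ - 1 - (i - r)) else min (r - i - 1) (ℓ - r + i)

@[simp] theorem cycDist_self (ℓ i : ℕ) : cycDist ℓ i i = 0 := by simp [cycDist]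

namespace CycleCoords

variable {V : Type*} {G : SimpleGraph V} {ℓ : ℕ} {a : ℕ → V} (c : CycleCoords G ℓ a)

theorem root_apply_succ {i : ℕ} (hi : i < ℓ) :
    (i + 1 = ℓ ∧ c.root (a (i + 1)) = 0) ∨ (i + 1 < ℓ ∧ c.root (a (i + 1)) = i + 1) := by
  rcases Nat.lt_or_ge (i + 1) ℓ with h | h
  · exact Or.inr ⟨h, c.root_apply _ h⟩
  · left
    have h1 : i + 1 = ℓ := by omega
    refine ⟨h1, ?_⟩
    have h2 : a (i + 1) = a 0 := by rw [h1]; simpa using c.labelling.2.2.1 0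
    rw [h2, c.root_apply 0 (by omega)]

theorem edge_cases {e : Sym2 V} (he : e ∈ G.edgeSet) :
    (∃ i < ℓ, e = s(a i, a (i + 1))) ∨ ∃ v, 0 < c.depth v ∧ e = s(c.par v, v) := by
  induction e with
  | h u v =>
    rcases c.adj_cases u v he with h | ⟨h, rfl⟩ | ⟨h, rfl⟩
    · exact Or.inl h
    · exact Or.inr ⟨v, h, rfl⟩
    · exact Or.inr ⟨u, h, Sym2.eq_swap⟩

theorem le_add_dist (φ : V → ℕ)
    (h1 : ∀ i < ℓ, φ (a (i + 1)) ≤ φ (a i) + 1 ∧ φ (a i) ≤ φ (a (i + 1)) + 1)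
    (h2 : ∀ v, 0 < c.depth v → φ (c.par v) ≤ φ v + 1 ∧ φ v ≤ φ (c.par v) + 1) (u v : V) :
    φ v ≤ φ u + G.dist u v := by
  refine c.connected.le_add_dist_of_adj φ (fun x y h => ?_) u v
  rcases c.adj_cases x y h with ⟨i, hi, h⟩ | ⟨hd, rfl⟩ | ⟨hd, rfl⟩
  · rcases Sym2.eq_iff.1 h with ⟨rfl, rfl⟩ | ⟨rfl, rfl⟩
    exacts [(h1 i hi).1, (h1 i hi).2]
  · exact (h2 _ hd).2
  · exact (h2 _ hd).1

theorem dist_root_le (v : V) : G.dist v (a (c.root v)) ≤ c.depth v := by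
  induction hn : c.depth v generalizing v with
  | zero => rw [← c.eq_of_depth_eq_zero v hn]; simp
  | succ n ih =>
    have hv : 0 < c.depth v := by omega
    have h1 := c.depth_par v hv
    have h2 := ih (c.par v) (by omega)
    rw [c.root_par v hv] at h2
    have h3 := c.connected.dist_triangle (u := v) (v := c.par v) (w := a (c.root v))
    have h4 : G.dist v (c.par v) = 1 := dist_eq_one_iff_adj.2 (c.adj_par v hv).symm
    omega

theorem dist_apply_add_le (c : CycleCoords G ℓ a) (i n : ℕ) : G.dist (a i) (a (i + n)) ≤ n := by
  induction n with
  | zero => simp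
  | succ n ih =>
    have h3 := c.connected.dist_triangle (u := a i) (v := a (i + n)) (w := a (i + (n + 1)))
    have h4 : G.dist (a (i + n)) (a (i + (n + 1))) = 1 :=
      dist_eq_one_iff_adj.2 (c.labelling.2.1 (i + n))
    omega

theorem dist_apply_le (c : CycleCoords G ℓ a) {i k : ℕ} (hi : i < ℓ) (hk : k < ℓ) :
    G.dist (a i) (a k) ≤ cycDist ℓ i k := by
  wlog hik : i ≤ k generalizing i k
  · rw [dist_comm, cycDist, max_comm, min_comm i k]
    exact this hk hi (by omega)
  have h1 := c.dist_apply_add_le i (k - i)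
  rw [show i + (k - i) = k by omega] at h1
  have h2 := c.dist_apply_add_le k (ℓ - (k - i))
  rw [show k + (ℓ - (k - i)) = i + ℓ by omega, c.labelling.2.2.1, dist_comm] at h2
  rw [cycDist]
  omega

theorem dist_le (u v : V) :
    G.dist u v ≤ c.depth u + cycDist ℓ (c.root u) (c.root v) + c.depth v := by
  have h1 := c.dist_root_le u
  have h2 := c.dist_root_le v
  rw [dist_comm] at h2
  have h3 := c.dist_apply_le (c.root_lt u) (c.root_lt v)
  have h4 := c.connected.dist_triangle (u := u) (v := a (c.root u)) (w := v)
  have h5 := c.connected.dist_triangle (u := a (c.root u)) (v := a (c.root v)) (w := v)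
  omega

theorem dist_eq {u v : V} (h : c.root u ≠ c.root v ∨ c.depth v = 0) :
    G.dist u v = c.depth u + cycDist ℓ (c.root u) (c.root v) + c.depth v := by
  refine le_antisymm (c.dist_le u v) ?_
  -- Inside the tree of `u` a lower bound for the distance is enough: it is exact at the root, the
  -- only vertex through which the tree can be left.
  set φ : V → ℕ := fun w => if c.root w = c.root u then
    max (c.depth u) (c.depth w) - min (c.depth u) (c.depth w) else
    c.depth u + cycDist ℓ (c.root u) (c.root w) + c.depth w with hφ
  have h0 : φ u = 0 := by simp [hφ]
  have h1 : φ v = c.depth u + cycDist ℓ (c.root u) (c.root v) + c.depth v := by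
    simp only [hφ]
    split_ifs with h2
    · rw [h2, cycDist_self]
      have : c.depth v = 0 := h.resolve_left (fun h => h h2.symm)
      omega
    · rfl
  have h2 := c.le_add_dist φ ?_ ?_ u v
  · rwa [h0, h1, zero_add] at h2
  · intro i hi
    have hr := c.root_lt u
    have h3 := c.labelling.1
    simp only [hφ, c.depth_apply, c.root_apply i hi]
    rcases c.root_apply_succ hi with ⟨h4, h5⟩ | ⟨h4, h5⟩ <;> rw [h5] <;>
      unfold cycDist <;> split_ifs <;> omega
  · intro w hw
    have h3 := c.depth_par w hw
    simp only [hφ, c.root_par w hw]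
    split_ifs <;> omega

theorem vertexEdgeDist_cycle (u : V) {i : ℕ} (hi : i < ℓ) :
    vertexEdgeDist G u s(a i, a (i + 1)) = c.depth u + cycEdgeDist ℓ (c.root u) i := by
  change min _ _ = _
  have hr := c.root_lt u
  have h3 := c.labelling.1
  rw [c.dist_eq (Or.inr (c.depth_apply _)), c.dist_eq (Or.inr (c.depth_apply _)), c.depth_apply,
    c.depth_apply, c.root_apply i hi]
  rcases c.root_apply_succ hi with ⟨h4, h5⟩ | ⟨h4, h5⟩ <;> rw [h5] <;>
    unfold cycDist cycEdgeDist <;> split_ifs <;> omega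

theorem vertexEdgeDist_tree {u v : V} (hv : 0 < c.depth v) (h : c.root u ≠ c.root v) :
    vertexEdgeDist G u s(c.par v, v) =
      c.depth u + cycDist ℓ (c.root u) (c.root v) + (c.depth v - 1) := by
  change min _ _ = _
  have h1 := c.depth_par v hv
  have h2 := c.root_par v hv
  rw [c.dist_eq (Or.inl h), c.dist_eq (v := c.par v) (Or.inl (by rwa [h2])), h2]
  omega

theorem vertexEdgeDist_tree_le (u : V) {v : V} (hv : 0 < c.depth v) :
    vertexEdgeDist G u s(c.par v, v) ≤
      c.depth u + cycDist ℓ (c.root u) (c.root v) + (c.depth v - 1) := by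
  have h0 : vertexEdgeDist G u s(c.par v, v) = min (G.dist u (c.par v)) (G.dist u v) := rfl
  have h1 := c.depth_par v hv
  have h2 := c.root_par v hv
  have h3 := c.dist_le u (c.par v)
  rw [h2] at h3
  omega

/-! ### Ancestry inside a tree. -/

/-- `w` is `x` or a descendant of `x` in the tree containing `x`. -/
def Desc (x w : V) : Prop := Relation.ReflTransGen (fun x y => 0 < c.depth y ∧ c.par y = x) x w

variable {c}

namespace Desc

variable {x y w : V}

theorem refl (x : V) : c.Desc x x := Relation.ReflTransGen.refl

theorem trans (h : c.Desc x y) (h' : c.Desc y w) : c.Desc x w := Relation.ReflTransGen.trans h h'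

theorem of_par (hw : 0 < c.depth w) (h : c.Desc x (c.par w)) : c.Desc x w :=
  Relation.ReflTransGen.tail h ⟨hw, rfl⟩

theorem par_of_ne (h : c.Desc x w) (hne : w ≠ x) : 0 < c.depth w ∧ c.Desc x (c.par w) := by
  rcases Relation.ReflTransGen.cases_tail h with h | ⟨y, hxy, hw, rfl⟩
  · exact absurd h hne
  · exact ⟨hw, hxy⟩

theorem exists_child (h : c.Desc x w) (hne : w ≠ x) :
    ∃ y, 0 < c.depth y ∧ c.par y = x ∧ c.Desc y w := by
  rcases Relation.ReflTransGen.cases_head h with h | ⟨y, hy, hyw⟩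
  · exact absurd h.symm hne
  · exact ⟨y, hy.1, hy.2, hyw⟩

theorem child (hx : 0 < c.depth x) : c.Desc (c.par x) x := of_par hx (refl _)

theorem root_eq (h : c.Desc x w) : c.root w = c.root x := by
  induction h with
  | refl => rfl
  | tail _ h ih =>
    obtain ⟨h, rfl⟩ := h
    rw [← c.root_par _ h, ih]

theorem add_dist_le (h : c.Desc x w) : c.depth x + G.dist x w ≤ c.depth w := by
  induction h with
  | refl => simp
  | @tail y w _ h ih =>
    obtain ⟨h, rfl⟩ := h
    have h1 := c.depth_par _ h
    have h2 := c.connected.dist_triangle (u := x) (v := c.par w) (w := w)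
    have h3 : G.dist (c.par w) w = 1 := dist_eq_one_iff_adj.2 (c.adj_par w h)
    omega

theorem depth_le (h : c.Desc x w) : c.depth x ≤ c.depth w := by
  have := h.add_dist_le
  omega

theorem eq_of_depth_le (h : c.Desc x w) (hd : c.depth w ≤ c.depth x) : w = x := by
  by_contra hne
  obtain ⟨h1, h2⟩ := h.par_of_ne hne
  have h3 := h2.depth_le
  have h4 := c.depth_par w h1
  omega

theorem total (h : c.Desc x w) (h' : c.Desc y w) :
    c.Desc x y ∨ c.Desc y x := by
  induction h with
  | refl => exact Or.inr h'
  | @tail z w hxz h ih =>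
    by_cases hyw : w = y
    · subst hyw
      exact Or.inl (Relation.ReflTransGen.tail hxz h)
    · obtain ⟨h1, rfl⟩ := h
      exact ih (h'.par_of_ne hyw).2

end Desc

variable (c)

theorem desc_root (w : V) : c.Desc (a (c.root w)) w := by
  induction hn : c.depth w generalizing w with
  | zero => rw [← c.eq_of_depth_eq_zero w hn]; exact Desc.refl _
  | succ n ih =>
    have hw : 0 < c.depth w := by omega
    have h1 := c.depth_par w hw
    have h2 := ih (c.par w) (by omega)
    rw [c.root_par w hw] at h2
    exact h2.of_par hw

/-- Two different vertices of the same depth in the same tree lie below different children of some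
vertex. -/
theorem exists_branching {v v' : V} (hr : c.root v = c.root v') (hd : c.depth v = c.depth v')
    (hne : v ≠ v') : ∃ x x', 0 < c.depth x ∧ c.depth x = c.depth x' ∧ c.par x = c.par x' ∧
      c.Desc x v ∧ c.Desc x' v' ∧ ¬ c.Desc x v' ∧ ¬ c.Desc x' v := by
  induction hn : c.depth v generalizing v v' with
  | zero =>
    rw [c.eq_of_depth_eq_zero v hn, c.eq_of_depth_eq_zero v' (by omega), hr] at hne
    exact absurd rfl hne
  | succ n ih =>
    have hv : 0 < c.depth v := by omega
    have hv' : 0 < c.depth v' := by omega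
    have h1 := c.depth_par v hv
    have h2 := c.depth_par v' hv'
    by_cases hp : c.par v = c.par v'
    · exact ⟨v, v', hv, hd, hp, Desc.refl _, Desc.refl _,
        fun h => hne (h.eq_of_depth_le hd.ge).symm, fun h => hne (h.eq_of_depth_le hd.le)⟩
    · obtain ⟨x, x', hx, hxx, hpx, hxv, hxv', hn1, hn2⟩ :=
        ih (v := c.par v) (v' := c.par v') (by rw [c.root_par v hv, c.root_par v' hv', hr])
          (by omega) hp (by omega)
      refine ⟨x, x', hx, hxx, hpx, hxv.of_par hv, hxv'.of_par hv', fun h => hn1 ?_,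
        fun h => hn2 ?_⟩
      · refine (h.par_of_ne ?_).2
        rintro rfl
        have := hxv.depth_le
        omega
      · refine (h.par_of_ne ?_).2
        rintro rfl
        have := hxv'.depth_le
        omega

/-- The subtree of `x` is entered only through `par x`; the potential is frozen at `dist s (par x) +
1` on it. -/
theorem dist_par_lt {s x : V} (hx : 0 < c.depth x) (hs : ¬ c.Desc x s) :
    G.dist s (c.par x) + 1 ≤ G.dist s x := by
  classical
  set φ : V → ℕ := fun w => if c.Desc x w then G.dist s (c.par x) + 1 else G.dist s w with hφ
  have h0 : φ s = 0 := by simp [hφ, hs]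
  have h1 : φ x = G.dist s (c.par x) + 1 := by simp [hφ, Desc.refl]
  have h2 := c.le_add_dist φ ?_ ?_ s x
  · omega
  · intro i hi
    have hna : ∀ i, ¬ c.Desc x (a i) := fun i h => by
      have := h.depth_le
      rw [c.depth_apply] at this
      omega
    simp only [hφ, hna, if_false]
    have h3 := (c.labelling.2.1 i).diff_dist_adj (u := s)
    omega
  · intro w hw
    simp only [hφ]
    by_cases h3 : c.Desc x w
    · rw [if_pos h3]
      by_cases h4 : w = x
      · subst h4
        have : ¬ c.Desc w (c.par w) := fun h => by
          have := h.depth_le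
          have := c.depth_par w hw
          omega
        rw [if_neg this]
        omega
      · rw [if_pos (h3.par_of_ne h4).2]
        omega
    · have h4 : ¬ c.Desc x (c.par w) := fun h => h3 (h.of_par hw)
      rw [if_neg h3, if_neg h4]
      have h3 := (c.adj_par w hw).diff_dist_adj (u := s)
      omega

/-- A path from `s` to `w` climbs to `par x`, of depth `depth x - 1`, and then has to reach the
depth of `w`. The second term truncates to `0` when `w` is shallower than that. -/
theorem le_dist_of_not_desc {s x w : V} (hx : 0 < c.depth x) (hs : c.Desc x s)
    (hw : ¬ c.Desc x w) :
    c.depth s + 1 - c.depth x + (c.depth w + 1 - c.depth x) ≤ G.dist s w := by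
  classical
  set φ : V → ℕ := fun w => if c.Desc x w then c.depth s - c.depth w else
    c.depth s + 1 - c.depth x + (c.depth w + 1 - c.depth x) with hφ
  have h0 : φ s = 0 := by simp [hφ, hs]
  have h1 : φ w = c.depth s + 1 - c.depth x + (c.depth w + 1 - c.depth x) := by simp [hφ, hw]
  have h2 := c.le_add_dist φ ?_ ?_ s w
  · omega
  · intro i hi
    have hna : ∀ i, ¬ c.Desc x (a i) := fun i h => by
      have := h.depth_le
      rw [c.depth_apply] at this
      omega
    simp only [hφ, hna, if_false, c.depth_apply]
    omega
  · intro w hw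
    have h5 := c.depth_par w hw
    simp only [hφ]
    by_cases h3 : c.Desc x w
    · rw [if_pos h3]
      by_cases h4 : w = x
      · subst h4
        have : ¬ c.Desc w (c.par w) := fun h => by
          have := h.depth_le
          omega
        rw [if_neg this]
        have := hs.depth_le
        omega
      · rw [if_pos (h3.par_of_ne h4).2]
        omega
    · have h4 : ¬ c.Desc x (c.par w) := fun h => h3 (h.of_par hw)
      rw [if_neg h3, if_neg h4]
      omega

/-- A vertex below `x` is closer to an edge below `x` than it would be through `par x`. -/
theorem vertexEdgeDist_add_lt {s x v : V} (hx : 0 < c.depth x) (hs : c.Desc x s)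
    (hv : c.Desc x v) :
    vertexEdgeDist G s s(c.par v, v) + 2 * c.depth x ≤
      c.depth s + max (c.depth v - 1) (c.depth x) := by
  have h1 := hs.add_dist_le
  rw [dist_comm] at h1
  by_cases h : v = x
  · subst h
    have : vertexEdgeDist G s s(c.par v, v) ≤ G.dist s v := min_le_right _ _
    omega
  · have h2 : vertexEdgeDist G s s(c.par v, v) ≤ G.dist s (c.par v) := min_le_left _ _
    obtain ⟨h3, h4⟩ := hv.par_of_ne h
    have h5 := h4.add_dist_le
    have h6 := c.depth_par v h3
    have h7 := c.connected.dist_triangle (u := s) (v := x) (w := c.par v)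
    omega

/-- The way from `s` to the edge above `v` need not rise above `x`, while the way to the edge above
`v'` passes `par x`. -/
theorem vertexEdgeDist_lt_of_desc {s x v v' : V} (hx : 0 < c.depth x) (hs : c.Desc x s)
    (hv : c.Desc x v) (hv' : ¬ c.Desc x v') (hd : c.depth v = c.depth v') :
    vertexEdgeDist G s s(c.par v, v) < vertexEdgeDist G s s(c.par v', v') := by
  have h1 := c.vertexEdgeDist_add_lt hx hs hv
  have h2 := hv.depth_le
  have h3 := hs.depth_le
  have h4 := c.le_dist_of_not_desc hx hs hv'
  have hp : 0 < c.depth v' := by omega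
  have h5 := c.le_dist_of_not_desc hx hs (w := c.par v') (fun h => hv' (h.of_par hp))
  have h6 := c.depth_par v' hp
  have h7 : vertexEdgeDist G s s(c.par v', v') = min (G.dist s (c.par v')) (G.dist s v') := rfl
  omega

end CycleCoords

/-! ### Children, degrees and threads. -/

namespace CycleCoords

variable {V : Type*} [Fintype V] {G : SimpleGraph V} {ℓ : ℕ} {a : ℕ → V}
  (c : CycleCoords G ℓ a)

open Classical in
/-- The children of a vertex. -/
noncomputable def children (v : V) : Finset V :=
  Finset.univ.filter fun y => 0 < c.depth y ∧ c.par y = v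

theorem mem_children {v y : V} : y ∈ c.children v ↔ 0 < c.depth y ∧ c.par y = v := by
  simp [children]

theorem adj_apply_iff {i : ℕ} (hi : i < ℓ) (w : V) :
    G.Adj (a i) w ↔ w = a (i + 1) ∨ w = a (i + ℓ - 1) ∨ w ∈ c.children (a i) := by
  have hl := c.labelling
  have h3 := hl.1
  constructor
  · intro h
    rcases c.adj_cases _ _ h with ⟨k, hk, h⟩ | ⟨h, h'⟩ | ⟨h, -⟩
    · rcases Sym2.eq_iff.1 h with ⟨h1, rfl⟩ | ⟨h1, rfl⟩
      · left
        rw [hl.eq_of_lt hi hk h1]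
      · right; left
        rw [hl.apply_eq_iff] at h1 ⊢
        rw [Nat.mod_eq_of_lt hi] at h1
        rcases Nat.lt_or_ge (k + 1) ℓ with h4 | h4
        · rw [Nat.mod_eq_of_lt h4] at h1
          rw [h1, show k + 1 + ℓ - 1 = k + ℓ by omega, Nat.add_mod_right]
        · obtain rfl : ℓ = k + 1 := by omega
          rw [Nat.mod_self] at h1
          rw [h1]
          congr 1
          omega
    · exact Or.inr (Or.inr (c.mem_children.2 ⟨h, h'.symm⟩))
    · rw [c.depth_apply] at h
      omega
  · rintro (rfl | rfl | h)
    · exact hl.2.1 i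
    · have h4 := hl.2.1 (i + ℓ - 1)
      rw [show i + ℓ - 1 + 1 = i + ℓ by omega, hl.2.2.1] at h4
      exact h4.symm
    · obtain ⟨h, h'⟩ := c.mem_children.1 h
      rw [← h']
      exact c.adj_par _ h

theorem adj_iff_of_depth_pos {v : V} (hv : 0 < c.depth v) (w : V) :
    G.Adj v w ↔ w = c.par v ∨ w ∈ c.children v := by
  constructor
  · intro h
    rcases c.adj_cases _ _ h with ⟨k, hk, h⟩ | ⟨h, h'⟩ | ⟨-, h⟩
    · rcases Sym2.eq_iff.1 h with ⟨rfl, rfl⟩ | ⟨rfl, rfl⟩ <;> simp [c.depth_apply] at hv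
    · exact Or.inr (c.mem_children.2 ⟨h, h'.symm⟩)
    · exact Or.inl h
  · rintro (rfl | h)
    · exact (c.adj_par v hv).symm
    · obtain ⟨h1, rfl⟩ := c.mem_children.1 h
      exact c.adj_par _ h1

theorem degree_eq_of_depth_pos [DecidableRel G.Adj] {v : V} (hv : 0 < c.depth v) :
    G.degree v = 1 + (c.children v).card := by
  classical
  have h : G.neighborFinset v = insert (c.par v) (c.children v) := by
    ext w
    rw [mem_neighborFinset, c.adj_iff_of_depth_pos hv, Finset.mem_insert]
  rw [← card_neighborFinset_eq_degree, h, Finset.card_insert_of_notMem, add_comm]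
  intro h
  obtain ⟨h1, h2⟩ := c.mem_children.1 h
  have h3 := c.depth_par v hv
  have h4 := c.depth_par _ h1
  rw [h2] at h4
  omega

theorem degree_eq_of_depth_eq_zero [DecidableRel G.Adj] {v : V} (hv : c.depth v = 0) :
    G.degree v = 2 + (c.children v).card := by
  classical
  have hl := c.labelling
  have h3 := hl.1
  have hr := c.root_lt v
  have hva := c.eq_of_depth_eq_zero v hv
  have hnot : ∀ i, a i ∉ c.children v := fun i h => by
    have := (c.mem_children.1 h).1
    rw [c.depth_apply] at this
    omega
  generalize c.root v = i at hr hva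
  subst hva
  have h : G.neighborFinset (a i) =
      insert (a (i + 1)) (insert (a (i + ℓ - 1)) (c.children (a i))) := by
    ext w
    rw [mem_neighborFinset, c.adj_apply_iff hr, Finset.mem_insert, Finset.mem_insert]
  rw [← card_neighborFinset_eq_degree, h, Finset.card_insert_of_notMem,
    Finset.card_insert_of_notMem (hnot _)]
  · omega
  · rw [Finset.mem_insert, not_or]
    refine ⟨fun h => ?_, hnot _⟩
    rw [hl.apply_eq_iff] at h
    have h5 : (i + ℓ - 1) % ℓ = if i = 0 then ℓ - 1 else i - 1 := by
      split_ifs with h6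
      · subst h6
        rw [Nat.mod_eq_of_lt (by omega)]
        omega
      · rw [show i + ℓ - 1 = i - 1 + ℓ by omega, Nat.add_mod_right, Nat.mod_eq_of_lt (by omega)]
    rw [h5] at h
    rcases Nat.lt_or_ge (i + 1) ℓ with h4 | h4
    · rw [Nat.mod_eq_of_lt h4] at h
      split_ifs at h <;> omega
    · obtain rfl : ℓ = i + 1 := by omega
      rw [Nat.mod_self] at h
      split_ifs at h <;> omega

theorem isBranchingVertex_iff [DecidableRel G.Adj] (v : V) :
    IsBranchingVertex G v ↔ 2 ≤ (c.children v).card := by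
  rw [IsBranchingVertex, c.mem_cycleVertices]
  rcases Nat.eq_zero_or_pos (c.depth v) with h | h
  · have := c.degree_eq_of_depth_eq_zero h
    omega
  · have := c.degree_eq_of_depth_pos h
    omega

theorem three_le_degree [DecidableRel G.Adj] {v : V} (h : 2 ≤ (c.children v).card) :
    3 ≤ G.degree v := by
  rcases Nat.eq_zero_or_pos (c.depth v) with h0 | h0
  · have := c.degree_eq_of_depth_eq_zero h0
    omega
  · have := c.degree_eq_of_depth_pos h0
    omega

/-- `x :: r` is a path going down from `x` to a leaf, whose vertices have no other children. -/
inductive IsDownPath : V → List V → Prop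
  | leaf (x : V) (hx : 0 < c.depth x) (h : c.children x = ∅) : IsDownPath x []
  | cons (x y : V) (r : List V) (hx : 0 < c.depth x) (h : c.children x = {y})
      (hr : IsDownPath y r) : IsDownPath x (y :: r)

variable {c}

namespace IsDownPath

variable {x : V} {r : List V}

theorem depth_pos (h : c.IsDownPath x r) : 0 < c.depth x := by cases h <;> assumption

theorem unique {r' : List V} (h : c.IsDownPath x r) (h' : c.IsDownPath x r') : r = r' := by
  induction h generalizing r' with
  | leaf x hx h =>
    cases h' with
    | leaf => rfl
    | cons _ y r _ h2 => rw [h] at h2; exact absurd h2.symm (Finset.singleton_ne_empty y)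
  | cons x y r hx h hr ih =>
    cases h' with
    | leaf _ _ h2 => rw [h] at h2; exact absurd h2 (Finset.singleton_ne_empty y)
    | cons _ y' r' _ h2 hr' =>
      rw [h, Finset.singleton_inj] at h2
      subst h2
      rw [ih hr']

theorem mem_iff (h : c.IsDownPath x r) (w : V) : w ∈ x :: r ↔ c.Desc x w := by
  induction h with
  | leaf x hx h =>
    rw [List.mem_singleton]
    constructor
    · rintro rfl
      exact Desc.refl _
    · intro hd
      by_contra hne
      obtain ⟨y, hy, hyx, -⟩ := hd.exists_child hne
      have := c.mem_children.2 ⟨hy, hyx⟩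
      simp [h] at this
  | cons x y r hx h hr ih =>
    rw [List.mem_cons, ih]
    have hy := c.mem_children.1 (h ▸ Finset.mem_singleton_self y : y ∈ c.children x)
    constructor
    · rintro (rfl | h')
      · exact Desc.refl _
      · exact (hy.2 ▸ Desc.child hy.1 : c.Desc x y).trans h'
    · intro hd
      by_contra! hne
      obtain ⟨z, hz, hzx, hzw⟩ := hd.exists_child hne.1
      have := c.mem_children.2 ⟨hz, hzx⟩
      rw [h, Finset.mem_singleton] at this
      exact hne.2 (this ▸ hzw)

theorem nodup (h : c.IsDownPath x r) : (x :: r).Nodup := by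
  induction h with
  | leaf x hx h => simp
  | cons x y r hx h hr ih =>
    rw [List.nodup_cons]
    refine ⟨fun hm => ?_, ih⟩
    rw [hr.mem_iff] at hm
    have hy := c.mem_children.1 (h ▸ Finset.mem_singleton_self y : y ∈ c.children x)
    have h1 := c.depth_par y hy.1
    have h2 := hm.depth_le
    rw [hy.2] at h1
    omega

theorem isChain (h : c.IsDownPath x r) : List.IsChain G.Adj (x :: r) := by
  induction h with
  | leaf x hx h => simp
  | cons x y r hx h hr ih =>
    rw [List.isChain_cons_cons]
    have hy := c.mem_children.1 (h ▸ Finset.mem_singleton_self y : y ∈ c.children x)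
    exact ⟨hy.2 ▸ c.adj_par y hy.1, ih⟩

theorem degree_of_mem_dropLast [DecidableRel G.Adj] (h : c.IsDownPath x r) :
    ∀ w ∈ (x :: r).dropLast, G.degree w = 2 := by
  induction h with
  | leaf x hx h => simp
  | cons x y r hx h hr ih =>
    rw [List.dropLast_cons_cons]
    intro w hw
    rcases List.mem_cons.1 hw with rfl | hw
    · rw [c.degree_eq_of_depth_pos hx, h, Finset.card_singleton]
    · exact ih w hw

theorem degree_getLast [DecidableRel G.Adj] (h : c.IsDownPath x r) :
    G.degree ((x :: r).getLast (List.cons_ne_nil _ _)) = 1 := by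
  induction h with
  | leaf x hx h =>
    rw [List.getLast_singleton, c.degree_eq_of_depth_pos hx, h, Finset.card_empty]
  | cons x y r hx h hr ih => rwa [List.getLast_cons (List.cons_ne_nil _ _)]

theorem mem_threads [DecidableRel G.Adj] (h : c.IsDownPath x r) : x :: r ∈ threads G (c.par x) :=
  ⟨h.nodup, List.isChain_cons_cons.2 ⟨c.adj_par x h.depth_pos, h.isChain⟩,
    h.degree_of_mem_dropLast, List.cons_ne_nil _ _, h.degree_getLast⟩

/-- A thread cannot run towards the cycle. Induction from its leaf: a vertex of degree 2 that has a
child is off the cycle and has no second child, so its predecessor on the thread is its parent. -/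
theorem of_thread [DecidableRel G.Adj] {v : V} (h1 : G.Adj v x) (h2 : List.IsChain G.Adj (x :: r))
    (h3 : (v :: x :: r).Nodup) (h4 : ∀ w ∈ (x :: r).dropLast, G.degree w = 2)
    (h5 : G.degree ((x :: r).getLast (List.cons_ne_nil _ _)) = 1) :
    c.IsDownPath x r ∧ c.par x = v := by
  induction r generalizing x v with
  | nil =>
    rw [List.getLast_singleton] at h5
    have hx : 0 < c.depth x := by
      by_contra h
      have := c.degree_eq_of_depth_eq_zero (v := x) (by omega)
      omega
    have hc : c.children x = ∅ := by
      have := c.degree_eq_of_depth_pos hx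
      rw [← Finset.card_eq_zero]
      omega
    refine ⟨.leaf x hx hc, ?_⟩
    rcases (c.adj_iff_of_depth_pos hx v).1 h1.symm with h | h
    · exact h.symm
    · simp [hc] at h
  | cons y r ih =>
    rw [List.isChain_cons_cons] at h2
    rw [List.dropLast_cons_cons] at h4
    rw [List.getLast_cons (List.cons_ne_nil _ _)] at h5
    obtain ⟨hd, hp⟩ := ih h2.1 h2.2 (List.nodup_cons.1 h3).2
      (fun w hw => h4 w (List.mem_cons_of_mem _ hw)) h5
    have hdeg := h4 x List.mem_cons_self
    have hy : y ∈ c.children x := c.mem_children.2 ⟨hd.depth_pos, hp⟩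
    have hcard : 0 < (c.children x).card := Finset.card_pos.2 ⟨y, hy⟩
    have hx : 0 < c.depth x := by
      by_contra h
      have := c.degree_eq_of_depth_eq_zero (v := x) (by omega)
      omega
    have hc : c.children x = {y} := by
      have := c.degree_eq_of_depth_pos hx
      obtain ⟨z, hz⟩ := Finset.card_eq_one.1 (by omega : (c.children x).card = 1)
      rw [hz, Finset.mem_singleton] at hy
      rw [hz, hy]
    refine ⟨.cons x y r hx hc hd, ?_⟩
    rcases (c.adj_iff_of_depth_pos hx v).1 h1.symm with h | h
    · exact h.symm
    · rw [hc, Finset.mem_singleton] at h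
      subst h
      simp at h3

end IsDownPath

variable (c)

theorem mem_threads_iff [DecidableRel G.Adj] {v : V} (hv : 3 ≤ G.degree v) (p : List V) :
    p ∈ threads G v ↔ ∃ x r, p = x :: r ∧ c.par x = v ∧ c.IsDownPath x r := by
  constructor
  · rintro ⟨h1, h2, h3, hne, h4⟩
    cases p with
    | nil => exact absurd rfl hne
    | cons x r =>
      -- `threads` does not itself forbid that the path returns to `v`; the degree of `v` does.
      have hvp : v ∉ x :: r := by
        intro h
        rw [← List.dropLast_append_getLast hne, List.mem_append, List.mem_singleton] at h
        rcases h with h | h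
        · have := h3 v h
          omega
        · rw [← h] at h4
          omega
      rw [List.isChain_cons_cons] at h2
      obtain ⟨h5, h6⟩ := IsDownPath.of_thread (c := c) h2.1 h2.2
        (List.nodup_cons.2 ⟨hvp, h1⟩) h3 h4
      exact ⟨x, r, rfl, h6, h5⟩
  · rintro ⟨x, r, rfl, rfl, h⟩
    exact h.mem_threads

/-- No vertex below `x` has two children. -/
def IsPendant (x : V) : Prop := ∀ w, c.Desc x w → (c.children w).card ≤ 1

variable {c} in
theorem IsDownPath.isPendant {x : V} {r : List V} (h : c.IsDownPath x r) : c.IsPendant x := by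
  induction h with
  | leaf x hx h =>
    intro w hw
    have := ((IsDownPath.leaf x hx h).mem_iff w).2 hw
    rw [List.mem_singleton.1 this, h]
    simp
  | cons x y r hx h hr ih =>
    intro w hw
    have := ((IsDownPath.cons x y r hx h hr).mem_iff w).2 hw
    rcases List.mem_cons.1 this with rfl | h'
    · simp [h]
    · exact ih w ((hr.mem_iff w).1 h')

theorem exists_depth_le : ∃ N, ∀ v, c.depth v ≤ N :=
  ⟨Finset.univ.sup c.depth, fun v => Finset.le_sup (f := c.depth) (Finset.mem_univ v)⟩

theorem IsPendant.exists_isDownPath {x : V} (h : c.IsPendant x) (hx : 0 < c.depth x) :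
    ∃ r, c.IsDownPath x r := by
  obtain ⟨N, hN⟩ := c.exists_depth_le
  induction hn : N - c.depth x generalizing x with
  | zero =>
    refine ⟨[], .leaf x hx (Finset.eq_empty_of_forall_notMem fun y hy => ?_)⟩
    obtain ⟨h1, rfl⟩ := c.mem_children.1 hy
    have h2 := c.depth_par y h1
    have h3 := hN y
    omega
  | succ n ih =>
    have h1 := h x (Desc.refl x)
    rcases Nat.eq_zero_or_pos (c.children x).card with h0 | h0
    · exact ⟨[], .leaf x hx (Finset.card_eq_zero.1 h0)⟩
    · obtain ⟨y, hy⟩ := Finset.card_eq_one.1 (by omega : (c.children x).card = 1)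
      obtain ⟨h2, rfl⟩ := c.mem_children.1 (hy ▸ Finset.mem_singleton_self y : y ∈ c.children x)
      have h3 := c.depth_par y h2
      obtain ⟨r, hr⟩ := ih (x := y) (fun w hw => h w ((Desc.child h2).trans hw)) h2 (by omega)
      exact ⟨y :: r, .cons _ y r hx hy hr⟩

open Classical in
/-- The first vertices of the threads attached to `v`. -/
noncomputable def threadHeads (v : V) : Finset V := (c.children v).filter c.IsPendant

theorem mem_threadHeads {v x : V} :
    x ∈ c.threadHeads v ↔ 0 < c.depth x ∧ c.par x = v ∧ c.IsPendant x := by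
  simp [threadHeads, mem_children, and_assoc]

open Classical in
/-- The first vertices of the threads attached to `v` that contain a vertex of `S`. -/
noncomputable def hitThreadHeads (S : Finset V) (v : V) : Finset V :=
  (c.threadHeads v).filter fun x => ∃ s ∈ S, c.Desc x s

theorem mem_hitThreadHeads {S : Finset V} {v x : V} :
    x ∈ c.hitThreadHeads S v ↔ x ∈ c.threadHeads v ∧ ∃ s ∈ S, c.Desc x s := by
  simp [hitThreadHeads]

/-- A thread is determined by its first vertex, so counting threads becomes counting certain
children. -/
theorem exists_threads_eq_image [DecidableRel G.Adj] : ∃ f : V → List V, Function.Injective f ∧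
    (∀ x, 0 < c.depth x → c.IsPendant x → ∀ w, w ∈ f x ↔ c.Desc x w) ∧
    ∀ v, 3 ≤ G.degree v → threads G v = f '' c.threadHeads v := by
  have : ∀ x, ∃ r, 0 < c.depth x → c.IsPendant x → c.IsDownPath x r := by
    intro x
    by_cases h : 0 < c.depth x ∧ c.IsPendant x
    · obtain ⟨r, hr⟩ := h.2.exists_isDownPath c h.1
      exact ⟨r, fun _ _ => hr⟩
    · exact ⟨[], fun h1 h2 => absurd ⟨h1, h2⟩ h⟩
  choose r hr using this
  refine ⟨fun x => x :: r x, fun x y h => (List.cons.inj h).1,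
    fun x h1 h2 w => (hr x h1 h2).mem_iff w, fun v hv => ?_⟩
  ext p
  rw [c.mem_threads_iff hv]
  constructor
  · rintro ⟨x, r', rfl, h1, h2⟩
    refine ⟨x, c.mem_threadHeads.2 ⟨h2.depth_pos, h1, h2.isPendant⟩, ?_⟩
    simp only
    rw [(hr x h2.depth_pos h2.isPendant).unique h2]
  · rintro ⟨x, hx, rfl⟩
    obtain ⟨h1, h2, h3⟩ := c.mem_threadHeads.1 hx
    exact ⟨x, r x, rfl, h2, hr x h1 h3⟩

theorem isBranchResolving_iff [DecidableRel G.Adj] (S : Finset V) : IsBranchResolving G S ↔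
    ∀ v, 3 ≤ G.degree v → (c.threadHeads v).card ≤ (c.hitThreadHeads S v).card + 1 := by
  obtain ⟨f, hf, hmem, himg⟩ := c.exists_threads_eq_image
  refine forall_congr' fun v => forall_congr' fun hv => ?_
  have h1 : (threads G v).ncard = (c.threadHeads v).card := by
    rw [himg v hv, Set.ncard_image_of_injective _ hf, Set.ncard_coe_finset]
  have h2 : {p ∈ threads G v | ∃ s ∈ S, s ∈ p} = f '' c.hitThreadHeads S v := by
    ext p
    rw [himg v hv]
    constructor
    · rintro ⟨⟨x, hx, rfl⟩, s, hs, hsp⟩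
      obtain ⟨h1, h2, h3⟩ := c.mem_threadHeads.1 hx
      exact ⟨x, c.mem_hitThreadHeads.2 ⟨hx, s, hs, (hmem x h1 h3 s).1 hsp⟩, rfl⟩
    · rintro ⟨x, hx, rfl⟩
      obtain ⟨hx, s, hs, hsp⟩ := c.mem_hitThreadHeads.1 hx
      obtain ⟨h1, h2, h3⟩ := c.mem_threadHeads.1 hx
      exact ⟨⟨x, hx, rfl⟩, s, hs, (hmem x h1 h3 s).2 hsp⟩
  rw [h1, h2, Set.ncard_image_of_injective _ hf, Set.ncard_coe_finset]

theorem isBadVertex_iff [DecidableRel G.Adj] (v : V) : IsBadVertex G v ↔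
    c.depth v = 0 ∧ 2 ≤ (c.children v).card ∧ (c.threadHeads v).Nonempty := by
  obtain ⟨f, -, -, himg⟩ := c.exists_threads_eq_image
  rw [IsBadVertex, c.mem_cycleVertices]
  refine and_congr_right fun h0 => ?_
  have h1 := c.degree_eq_of_depth_eq_zero h0
  rw [show 4 ≤ G.degree v ↔ 2 ≤ (c.children v).card by omega]
  refine and_congr_right fun h2 => ?_
  rw [himg v (by omega), Set.image_nonempty, Finset.coe_nonempty]

theorem IsPendant.not_three_le_degree [DecidableRel G.Adj] {x w : V} (h : c.IsPendant x)
    (hx : 0 < c.depth x) (hw : c.Desc x w) : ¬ 3 ≤ G.degree w := by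
  have h1 := h w hw
  have h2 := hw.depth_le
  have h3 := c.degree_eq_of_depth_pos (v := w) (by omega)
  omega

/-! ### Consequences of being branch-resolving, and of minimality. -/

section BranchResolving

variable [DecidableRel G.Adj] {S : Finset V}

/-- At a deepest vertex with two children below `v`, every child starts a thread, so at least one of
these threads is hit. -/
theorem exists_desc_of_two_le_card (hS : IsBranchResolving G S) {v : V}
    (hv : 2 ≤ (c.children v).card) : ∃ s ∈ S, c.Desc v s := by
  classical
  obtain ⟨w, hw, hmax⟩ := Finset.exists_max_image
    (Finset.univ.filter fun w => c.Desc v w ∧ 2 ≤ (c.children w).card) c.depth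
    ⟨v, by simp [Desc.refl, hv]⟩
  simp only [Finset.mem_filter, Finset.mem_univ, true_and] at hw hmax
  have h1 : c.threadHeads w = c.children w := by
    rw [threadHeads, Finset.filter_eq_self]
    intro x hx u hu
    obtain ⟨hx0, rfl⟩ := c.mem_children.1 hx
    by_contra h
    have h2 := hmax u ⟨(hw.1.trans (Desc.child hx0)).trans hu, by omega⟩
    have h3 := hu.depth_le
    have h4 := c.depth_par x hx0
    omega
  have h2 := (c.isBranchResolving_iff S).1 hS w (c.three_le_degree hw.2)
  rw [h1] at h2
  obtain ⟨x, hx⟩ := Finset.card_pos.1 (by omega : 0 < (c.hitThreadHeads S w).card)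
  obtain ⟨hx, s, hs, hxs⟩ := c.mem_hitThreadHeads.1 hx
  obtain ⟨h3, rfl, -⟩ := c.mem_threadHeads.1 hx
  exact ⟨s, hs, (hw.1.trans (Desc.child h3)).trans hxs⟩

theorem isPendant_of_forall_not_desc (hS : IsBranchResolving G S) {x : V}
    (hx : ∀ s ∈ S, ¬ c.Desc x s) : c.IsPendant x := by
  intro w hw
  by_contra h
  obtain ⟨s, hs, hws⟩ := c.exists_desc_of_two_le_card hS (v := w) (by omega)
  exact hx s hs (hw.trans hws)

/-- Siblings with nothing of `S` below them would start two unhit threads at the same vertex. -/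
theorem exists_desc_of_par_eq (hS : IsBranchResolving G S) {x x' : V} (hx : 0 < c.depth x)
    (hx' : 0 < c.depth x') (hp : c.par x = c.par x') (hne : x ≠ x') :
    ∃ s ∈ S, c.Desc x s ∨ c.Desc x' s := by
  classical
  by_contra! h
  have h1 := c.isPendant_of_forall_not_desc hS (fun s hs => (h s hs).1)
  have h2 := c.isPendant_of_forall_not_desc hS (fun s hs => (h s hs).2)
  have h3 : ({x, x'} : Finset V) ⊆ c.threadHeads (c.par x) \ c.hitThreadHeads S (c.par x) := by
    intro y hy
    rw [Finset.mem_sdiff, mem_hitThreadHeads, mem_threadHeads]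
    rcases Finset.mem_insert.1 hy with rfl | hy
    · exact ⟨⟨hx, rfl, h1⟩, fun ⟨_, s, hs, hys⟩ => (h s hs).1 hys⟩
    · obtain rfl := Finset.mem_singleton.1 hy
      exact ⟨⟨hx', hp.symm, h2⟩, fun ⟨_, s, hs, hys⟩ => (h s hs).2 hys⟩
  have h4 := Finset.card_le_card h3
  have h8 : c.hitThreadHeads S (c.par x) ⊆ c.threadHeads (c.par x) := Finset.filter_subset _ _
  rw [Finset.card_pair hne, Finset.card_sdiff_of_subset h8] at h4
  have h5 : c.threadHeads (c.par x) ⊆ c.children (c.par x) := Finset.filter_subset _ _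
  have h6 := Finset.card_le_card h5
  have h7 := (c.isBranchResolving_iff S).1 hS (c.par x) (c.three_le_degree (by omega))
  omega

theorem card_children_le_one_of_forall_root_ne (hS : IsBranchResolving G S) {v : V}
    (hv : ∀ s ∈ S, c.root s ≠ c.root v) : (c.children v).card ≤ 1 := by
  by_contra h
  obtain ⟨s, hs, hvs⟩ := c.exists_desc_of_two_le_card hS (v := v) (by omega)
  exact hv s hs hvs.root_eq

/-- A tree that misses `S` cannot branch, so it is a path starting at its root. -/
theorem eq_of_forall_root_ne (hS : IsBranchResolving G S) {v v' : V}
    (hv : ∀ s ∈ S, c.root s ≠ c.root v) (hr : c.root v = c.root v')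
    (hd : c.depth v = c.depth v') : v = v' := by
  by_contra hne
  obtain ⟨x, x', hx, hxx, hp, hxv, hxv', hn, -⟩ := c.exists_branching hr hd hne
  obtain ⟨s, hs, h | h⟩ := c.exists_desc_of_par_eq hS hx (by omega) hp
    (by rintro rfl; exact hn hxv')
  · exact hv s hs (by rw [h.root_eq, hxv.root_eq])
  · exact hv s hs (by rw [h.root_eq, hr, hxv'.root_eq])

/-- By minimality, removing `s` violates the condition at some vertex; that vertex has at least two
threads, and `s` lies on one of them. -/
theorem exists_two_le_card_children (hS : S ∈ minBranchResolvingSets G) {s : V} (hs : s ∈ S) :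
    ∃ v, 2 ≤ (c.children v).card ∧ c.Desc v s := by
  classical
  have h1 : ¬ IsBranchResolving G (S.erase s) := fun h => by
    have := hS.2.1 _ h
    rw [Finset.card_erase_of_mem hs] at this
    have := Finset.card_pos.2 ⟨s, hs⟩
    omega
  rw [c.isBranchResolving_iff] at h1
  push Not at h1
  obtain ⟨v, hv, h2⟩ := h1
  have h3 := (c.isBranchResolving_iff S).1 hS.1 v hv
  obtain ⟨x, hx, hx'⟩ := Finset.exists_mem_notMem_of_card_lt_card
    (by omega : (c.hitThreadHeads (S.erase s) v).card < (c.hitThreadHeads S v).card)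
  rw [mem_hitThreadHeads] at hx hx'
  obtain ⟨hx, t, ht, hxt⟩ := hx
  have hts : t = s := by
    by_contra hne
    exact hx' ⟨hx, t, Finset.mem_erase.2 ⟨hne, ht⟩, hxt⟩
  subst hts
  obtain ⟨h4, rfl, -⟩ := c.mem_threadHeads.1 hx
  have h5 : c.threadHeads (c.par x) ⊆ c.children (c.par x) := Finset.filter_subset _ _
  have h6 := Finset.card_le_card h5
  exact ⟨c.par x, by omega, (Desc.child h4).trans hxt⟩

/-- If all threads at `v` were hit, a vertex of `S` on one of them could be dropped. -/
theorem exists_forall_not_desc (hS : S ∈ minBranchResolvingSets G) {v : V}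
    (hv : 3 ≤ G.degree v) (hne : (c.threadHeads v).Nonempty) :
    ∃ x ∈ c.threadHeads v, ∀ s ∈ S, ¬ c.Desc x s := by
  classical
  by_contra! hall
  obtain ⟨x, hx⟩ := hne
  obtain ⟨s, hs, hxs⟩ := hall x hx
  -- Threads with different heads are disjoint: otherwise one head would lie properly below the
  -- other, placing a vertex of degree at least 3 inside a thread.
  have hother : ∀ v', 3 ≤ G.degree v' → ∀ x' ∈ c.threadHeads v', x' ≠ x →
      (∃ t ∈ S, c.Desc x' t) → ∃ t ∈ S.erase s, c.Desc x' t := by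
    rintro v' hv' x' hx' hne ⟨t, ht, hxt⟩
    refine ⟨t, Finset.mem_erase.2 ⟨?_, ht⟩, hxt⟩
    rintro rfl
    obtain ⟨h1, rfl, h2⟩ := c.mem_threadHeads.1 hx
    obtain ⟨h3, rfl, h4⟩ := c.mem_threadHeads.1 hx'
    rcases hxs.total hxt with h | h
    · exact h2.not_three_le_degree c h1 (h.par_of_ne hne).2 hv'
    · exact h4.not_three_le_degree c h3 (h.par_of_ne hne.symm).2 hv
  have h1 : IsBranchResolving G (S.erase s) := by
    rw [c.isBranchResolving_iff]
    intro v' hv'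
    have h2 := (c.isBranchResolving_iff S).1 hS.1 v' hv'
    by_cases hvv : v' = v
    · subst hvv
      have h3 : (c.threadHeads v').erase x ⊆ c.hitThreadHeads (S.erase s) v' := by
        intro y hy
        obtain ⟨h4, h5⟩ := Finset.mem_erase.1 hy
        exact c.mem_hitThreadHeads.2 ⟨h5, hother v' hv' y h5 h4 (hall y h5)⟩
      have h4 := Finset.card_le_card h3
      rw [Finset.card_erase_of_mem hx] at h4
      omega
    · have h3 : c.hitThreadHeads S v' ⊆ c.hitThreadHeads (S.erase s) v' := by
        intro y hy
        obtain ⟨h5, h6⟩ := c.mem_hitThreadHeads.1 hy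
        refine c.mem_hitThreadHeads.2 ⟨h5, hother v' hv' y h5 ?_ h6⟩
        rintro rfl
        rw [mem_threadHeads] at hx h5
        exact hvv (h5.2.1.symm.trans hx.2.1)
      have h4 := Finset.card_le_card h3
      omega
  have h2 := hS.2.1 _ h1
  rw [Finset.card_erase_of_mem hs] at h2
  have := Finset.card_pos.2 ⟨s, hs⟩
  omega

theorem exists_child_of_isBadVertex (hS : S ∈ minBranchResolvingSets G) {v : V}
    (hv : IsBadVertex G v) :
    ∃ x, 0 < c.depth x ∧ c.par x = v ∧ ∀ s ∈ S, ¬ c.Desc x s := by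
  obtain ⟨-, h1, h2⟩ := (c.isBadVertex_iff v).1 hv
  obtain ⟨x, hx, hxS⟩ := c.exists_forall_not_desc hS (c.three_le_degree h1) h2
  obtain ⟨h3, h4, -⟩ := c.mem_threadHeads.1 hx
  exact ⟨x, h3, h4, hxS⟩

/-- If `S` misses the branch at `x`, that branch is a thread, so a root that is not bad has `x` as
its only child. But a vertex of `S` in the tree lies below a branching vertex, here necessarily one
below `x`. -/
theorem exists_desc_of_not_isBadVertex (hS : S ∈ minBranchResolvingSets G) {x : V}
    (hx : 0 < c.depth x) (hx0 : c.depth (c.par x) = 0) (hbad : ¬ IsBadVertex G (c.par x))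
    (hact : ∃ s ∈ S, c.root s = c.root (c.par x)) : ∃ s ∈ S, c.Desc x s := by
  by_contra! h
  have h1 := c.isPendant_of_forall_not_desc hS.1 h
  have hxc : x ∈ c.children (c.par x) := c.mem_children.2 ⟨hx, rfl⟩
  have h2 : (c.children (c.par x)).card ≤ 1 := by
    by_contra h2
    exact hbad ((c.isBadVertex_iff _).2
      ⟨hx0, by omega, x, c.mem_threadHeads.2 ⟨hx, rfl, h1⟩⟩)
  obtain ⟨s, hs, hsr⟩ := hact
  obtain ⟨u, hu, hus⟩ := c.exists_two_le_card_children hS hs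
  have h3 : c.Desc (c.par x) u := by
    have := c.desc_root u
    rwa [← hus.root_eq, hsr, ← c.eq_of_depth_eq_zero _ hx0] at this
  obtain ⟨y, hy, hyx, hyu⟩ := h3.exists_child (by rintro rfl; omega)
  have h4 := Finset.card_le_one.1 h2 x hxc y (c.mem_children.2 ⟨hy, hyx⟩)
  subst h4
  exact h s hs (hyu.trans hus)

end BranchResolving

end CycleCoords

/-! ### Cycle arithmetic with three observers. -/

section Numeric

variable {L P Q R x y W W' : ℕ}

theorem cycDist_comm (L i k : ℕ) : cycDist L i k = cycDist L k i := by
  rw [cycDist, cycDist, max_comm, min_comm i k]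

theorem cycDist_of_two_mul_le (hik : x ≤ y) (h : 2 * (y - x) ≤ L) : cycDist L x y = y - x := by
  unfold cycDist; omega

theorem cycDist_of_le_two_mul (hik : x ≤ y) (h : L ≤ 2 * (y - x)) :
    cycDist L x y = L - (y - x) := by
  unfold cycDist; omega

theorem cycDist_eq_or (hik : x ≤ y) : cycDist L x y = y - x ∨ cycDist L x y = L - (y - x) := by
  rcases le_total (2 * (y - x)) L with h | h
  exacts [Or.inl (cycDist_of_two_mul_le hik h), Or.inr (cycDist_of_le_two_mul hik h)]

theorem cycDist_triple_cases (hPQ : P < Q) (hQR : Q < R) (h1 : 2 * (Q - P) ≤ L)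
    (h2 : 2 * (R - Q) ≤ L) (h3 : L ≤ 2 * (R - P)) (hR : R < L) (hx : x < L) :
    (x = P ∧ cycDist L Q x = Q - P ∧ cycDist L R x = L - (R - P)) ∨
    (x = Q ∧ cycDist L P x = Q - P ∧ cycDist L R x = R - Q) ∨
    (x = R ∧ cycDist L P x = L - (R - P) ∧ cycDist L Q x = R - Q) ∨
    (P < x ∧ x < Q ∧ cycDist L P x = x - P ∧ cycDist L Q x = Q - x ∧
      (cycDist L R x = R - x ∨ cycDist L R x = L - (R - x))) ∨
    (Q < x ∧ x < R ∧ cycDist L Q x = x - Q ∧ cycDist L R x = R - x ∧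
      (cycDist L P x = x - P ∨ cycDist L P x = L - (x - P))) ∨
    (R < x ∧ cycDist L R x = x - R ∧ cycDist L P x = L - (x - P) ∧
      (cycDist L Q x = x - Q ∨ cycDist L Q x = L - (x - Q))) ∨
    (x < P ∧ cycDist L R x = L - (R - x) ∧ cycDist L P x = P - x ∧
      (cycDist L Q x = Q - x ∨ cycDist L Q x = L - (Q - x))) := by
  have hc : ∀ i k, i ≤ k → (2 * (k - i) ≤ L → cycDist L k i = k - i) ∧
      (L ≤ 2 * (k - i) → cycDist L k i = L - (k - i)) ∧
      (cycDist L k i = k - i ∨ cycDist L k i = L - (k - i)) := fun i k h => by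
    rw [cycDist_comm]
    exact ⟨cycDist_of_two_mul_le h, cycDist_of_le_two_mul h, cycDist_eq_or h⟩
  rcases lt_trichotomy x P with h | rfl | h
  · exact Or.inr <| Or.inr <| Or.inr <| Or.inr <| Or.inr <| Or.inr
      ⟨h, (hc x R (by omega)).2.1 (by omega), (hc x P h.le).1 (by omega), (hc x Q (by omega)).2.2⟩
  · exact Or.inl ⟨rfl, (hc x Q hPQ.le).1 h1, (hc x R (by omega)).2.1 h3⟩
  rcases lt_trichotomy x Q with h' | rfl | h'
  · exact Or.inr <| Or.inr <| Or.inr <| Or.inl ⟨h, h', cycDist_of_two_mul_le h.le (by omega),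
      (hc x Q h'.le).1 (by omega), (hc x R (by omega)).2.2⟩
  · exact Or.inr <| Or.inl ⟨rfl, cycDist_of_two_mul_le h.le h1, (hc x R hQR.le).1 h2⟩
  rcases lt_trichotomy x R with h'' | rfl | h''
  · exact Or.inr <| Or.inr <| Or.inr <| Or.inr <| Or.inl ⟨h', h'',
      cycDist_of_two_mul_le h'.le (by omega), (hc x R h''.le).1 (by omega), cycDist_eq_or h.le⟩
  · exact Or.inr <| Or.inr <| Or.inl ⟨rfl, cycDist_of_le_two_mul h.le h3,
      cycDist_of_two_mul_le hQR.le h2⟩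
  · exact Or.inr <| Or.inr <| Or.inr <| Or.inr <| Or.inr <| Or.inl ⟨h'',
      cycDist_of_two_mul_le h''.le (by omega), cycDist_of_le_two_mul h.le (by omega),
      cycDist_eq_or h'.le⟩

/-- A position on an arc between consecutive observers minimises the sum of distances to the arc's
ends, which forces equal weights and then equal positions; the third observer excludes the mirror
image when an arc is exactly half the cycle. At an observer's own position only `≤` is assumed,
since distances inside one tree can be shorter than the way through the root. -/
theorem eq_of_cycDist_triple (hPQ : P < Q) (hQR : Q < R) (hRL : R < L) (h1 : 2 * (Q - P) ≤ L)
    (h2 : 2 * (R - Q) ≤ L) (h3 : L ≤ 2 * (R - P)) (hx : x < L) (hy : y < L) {DP DQ DR : ℕ}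
    (hPx : DP ≤ cycDist L P x + W) (hPx' : x ≠ P → DP = cycDist L P x + W)
    (hQx : DQ ≤ cycDist L Q x + W) (hQx' : x ≠ Q → DQ = cycDist L Q x + W)
    (hRx : DR ≤ cycDist L R x + W) (hRx' : x ≠ R → DR = cycDist L R x + W)
    (hPy : DP ≤ cycDist L P y + W') (hPy' : y ≠ P → DP = cycDist L P y + W')
    (hQy : DQ ≤ cycDist L Q y + W') (hQy' : y ≠ Q → DQ = cycDist L Q y + W')
    (hRy : DR ≤ cycDist L R y + W') (hRy' : y ≠ R → DR = cycDist L R y + W') : x = y := by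
  have key : ∀ {x W}, x < L → DP ≤ cycDist L P x + W → (x ≠ P → DP = cycDist L P x + W) →
    DQ ≤ cycDist L Q x + W → (x ≠ Q → DQ = cycDist L Q x + W) →
    DR ≤ cycDist L R x + W → (x ≠ R → DR = cycDist L R x + W) →
    (x = P ∧ DP ≤ W ∧ DQ = Q - P + W ∧ DR = L - (R - P) + W) ∨
    (x = Q ∧ DQ ≤ W ∧ DP = Q - P + W ∧ DR = R - Q + W) ∨
    (x = R ∧ DR ≤ W ∧ DP = L - (R - P) + W ∧ DQ = R - Q + W) ∨
    (P < x ∧ x < Q ∧ DP = x - P + W ∧ DQ = Q - x + W ∧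
      (DR = R - x + W ∨ DR = L - (R - x) + W)) ∨
    (Q < x ∧ x < R ∧ DQ = x - Q + W ∧ DR = R - x + W ∧
      (DP = x - P + W ∨ DP = L - (x - P) + W)) ∨
    (R < x ∧ DR = x - R + W ∧ DP = L - (x - P) + W ∧
      (DQ = x - Q + W ∨ DQ = L - (x - Q) + W)) ∨
    (x < P ∧ DR = L - (R - x) + W ∧ DP = P - x + W ∧
      (DQ = Q - x + W ∨ DQ = L - (Q - x) + W)) := by
    intro x W hx hP hP' hQ hQ' hR hR'
    rcases cycDist_triple_cases hPQ hQR h1 h2 h3 hRL hx with h | h | h | h | h | h | h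
    · left
      have : cycDist L P x = 0 := by rw [h.1, cycDist_self]
      omega
    · right; left
      have : cycDist L Q x = 0 := by rw [h.1, cycDist_self]
      omega
    · right; right; left
      have : cycDist L R x = 0 := by rw [h.1, cycDist_self]
      omega
    · right; right; right; left; omega
    · right; right; right; right; left; omega
    · right; right; right; right; right; left; omega
    · right; right; right; right; right; right; omega
  have hx := key hx hPx hPx' hQx hQx' hRx hRx'
  have hy := key hy hPy hPy' hQy hQy' hRy hRy'
  clear key hPx hPx' hQx hQx' hRx hRx' hPy hPy' hQy hQy' hRy hRy'
  rcases hx with hx | hx | hx | ⟨_, _, _, _, hx | hx⟩ | ⟨_, _, _, _, hx | hx⟩ |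
      ⟨_, _, _, hx | hx⟩ | ⟨_, _, _, hx | hx⟩ <;>
    rcases hy with hy | hy | hy | ⟨_, _, _, _, hy | hy⟩ | ⟨_, _, _, _, hy | hy⟩ |
      ⟨_, _, _, hy | hy⟩ | ⟨_, _, _, hy | hy⟩ <;> omega

end Numeric

/-! ### Cycle arithmetic with two observers, at `0` and `J`. -/

section Numeric

variable {L ℓ J P x y W W' : ℕ}

theorem cycDist_triangle {i k m : ℕ} (hi : i < L) (hk : k < L) (hm : m < L) :
    cycDist L i m ≤ cycDist L i k + cycDist L k m := by
  unfold cycDist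
  rcases le_total i k with h | h <;> rcases le_total k m with h' | h' <;>
    rcases le_total i m with h'' | h'' <;> simp only [max_eq_left, max_eq_right, min_eq_left,
      min_eq_right, h, h', h''] <;> omega

theorem cycDist_two_mul (ℓ i k : ℕ) : cycDist (2 * ℓ) (2 * i) (2 * k) = 2 * cycDist ℓ i k := by
  unfold cycDist
  omega

theorem cycDist_two_mul_add_one {i k : ℕ} (hi : i < ℓ) (hk : k < ℓ) :
    cycDist (2 * ℓ) (2 * i) (2 * k + 1) = 2 * cycEdgeDist ℓ i k + 1 := by
  unfold cycDist cycEdgeDist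
  split_ifs <;> omega

theorem cycDist_pair_cases (hJ : 0 < J) (hJℓ : J < ℓ) (hxJ : x ≠ J) :
    (x < J ∧ cycDist (2 * ℓ) 0 x = x ∧ cycDist (2 * ℓ) J x = J - x) ∨
    (J < x ∧ x ≤ ℓ ∧ cycDist (2 * ℓ) 0 x = x ∧ cycDist (2 * ℓ) J x = x - J) ∨
    (ℓ ≤ x ∧ x ≤ ℓ + J ∧ cycDist (2 * ℓ) 0 x = 2 * ℓ - x ∧ cycDist (2 * ℓ) J x = x - J) ∨
    (ℓ + J ≤ x ∧ cycDist (2 * ℓ) 0 x = 2 * ℓ - x ∧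
      cycDist (2 * ℓ) J x = 2 * ℓ - (x - J)) := by
  rcases lt_or_ge x J with h | h
  · refine Or.inl ⟨h, cycDist_of_two_mul_le (Nat.zero_le x) (by omega), ?_⟩
    rw [cycDist_comm]
    exact cycDist_of_two_mul_le h.le (by omega)
  rcases le_total x ℓ with h1 | h1
  · exact Or.inr <| Or.inl ⟨by omega, h1, cycDist_of_two_mul_le (Nat.zero_le x) (by omega),
      cycDist_of_two_mul_le h (by omega)⟩
  rcases le_total x (ℓ + J) with h2 | h2
  · exact Or.inr <| Or.inr <| Or.inl ⟨h1, h2, cycDist_of_le_two_mul (Nat.zero_le x) (by omega),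
      cycDist_of_two_mul_le h (by omega)⟩
  · exact Or.inr <| Or.inr <| Or.inr ⟨h2, cycDist_of_le_two_mul (Nat.zero_le x) (by omega),
      cycDist_of_le_two_mul h (by omega)⟩

/-- The difference of the distances to `0` and `J` is `± J` outside the arc `[0, J]` and its
antipode, where weights vanish. On these two arcs it is injective separately, so a confusion must be
between mirror positions, one on each. -/
theorem cycDist_pair (hJ : 0 < J) (hJℓ : J < ℓ) (hx0 : x ≠ 0) (hxJ : x ≠ J) (hy : y < 2 * ℓ)
    (hyJ : y ≠ J) (hxy : x < y)
    (hWx : W = 0 ∨ x < J ∨ (ℓ ≤ x ∧ x ≤ ℓ + J)) (hWy : W' = 0 ∨ y < J ∨ (ℓ ≤ y ∧ y ≤ ℓ + J))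
    (h0 : cycDist (2 * ℓ) 0 x + W = cycDist (2 * ℓ) 0 y + W')
    (h1 : cycDist (2 * ℓ) J x + W = cycDist (2 * ℓ) J y + W') :
    x < J ∧ ℓ ≤ y ∧ x + y = ℓ + J ∧ W + J = W' + ℓ := by
  rcases cycDist_pair_cases hJ hJℓ hxJ with h | h | h | h <;>
    rcases cycDist_pair_cases hJ hJℓ hyJ with h' | h' | h' | h' <;> omega

/-- A shortest way from `P` to `y` passes `0` or `J`, where the weighted distances to `x` and `y`
agree; from `P` the way to `x` avoids this detour. -/
theorem cycDist_lt_of_between (hP : 0 < P) (hPJ : P < J) (hJℓ : J < ℓ) (hx0 : x ≠ 0)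
    (hxJ : x < J) (hxy : x + y = ℓ + J) (hW : W + J = W' + ℓ) :
    cycDist (2 * ℓ) P x + W < cycDist (2 * ℓ) P y + W' := by
  have h1 : cycDist (2 * ℓ) P x = x - P ∨ cycDist (2 * ℓ) P x = P - x := by
    rcases le_total P x with h | h
    · exact Or.inl (cycDist_of_two_mul_le h (by omega))
    · rw [cycDist_comm]
      exact Or.inr (cycDist_of_two_mul_le h (by omega))
  have h2 : cycDist (2 * ℓ) P y = y - P ∨ cycDist (2 * ℓ) P y = 2 * ℓ - (y - P) :=
    cycDist_eq_or (by omega)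
  unfold cycDist at *
  omega

end Numeric

/-! ### Positions of edges on the subdivided cycle. -/

namespace CycleCoords

variable {V : Type*} {G : SimpleGraph V} {ℓ : ℕ} {a : ℕ → V} (c : CycleCoords G ℓ a)

/-- The position of an edge on the cycle with subdivided edges, and the odd number `2 d + 1` for
an edge at height `d` in a tree, or `0` for an edge of the cycle. -/
def HasPosition (e : Sym2 V) (x W : ℕ) : Prop :=
  (∃ v, 0 < c.depth v ∧ e = s(c.par v, v) ∧ x = 2 * c.root v ∧ W + 1 = 2 * c.depth v) ∨
  ∃ i < ℓ, e = s(a i, a (i + 1)) ∧ x = 2 * i + 1 ∧ W = 0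

variable {c} {e f : Sym2 V} {x y W W' : ℕ}

theorem exists_hasPosition (he : e ∈ G.edgeSet) : ∃ x W, c.HasPosition e x W := by
  rcases c.edge_cases he with ⟨i, hi, rfl⟩ | ⟨v, hv, rfl⟩
  · exact ⟨_, _, Or.inr ⟨i, hi, rfl, rfl, rfl⟩⟩
  · exact ⟨_, 2 * c.depth v - 1, Or.inl ⟨v, hv, rfl, rfl, by omega⟩⟩

theorem hasPosition_tree {v : V} (hv : 0 < c.depth v) :
    c.HasPosition s(c.par v, v) (2 * c.root v) (2 * c.depth v - 1) :=
  Or.inl ⟨v, hv, rfl, rfl, by omega⟩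

theorem hasPosition_cycle (c : CycleCoords G ℓ a) {i : ℕ} (hi : i < ℓ) :
    c.HasPosition s(a i, a (i + 1)) (2 * i + 1) 0 :=
  Or.inr ⟨i, hi, rfl, rfl, rfl⟩

namespace HasPosition

theorem lt (h : c.HasPosition e x W) : x < 2 * ℓ := by
  rcases h with ⟨v, -, -, rfl, -⟩ | ⟨i, hi, -, rfl, -⟩
  · have := c.root_lt v
    omega
  · omega

theorem mem_edgeSet (h : c.HasPosition e x W) : e ∈ G.edgeSet := by
  rcases h with ⟨v, hv, rfl, -, -⟩ | ⟨i, hi, rfl, -, -⟩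
  · exact c.adj_par v hv
  · exact c.labelling.2.1 i

theorem unique (h : c.HasPosition e x W) (h' : c.HasPosition e y W') : x = y := by
  have key : ∀ v i, 0 < c.depth v → s(c.par v, v) ≠ s(a i, a (i + 1)) := by
    intro v i hv h
    have : v = a i ∨ v = a (i + 1) := Sym2.mem_iff.1 (h ▸ Sym2.mem_mk_right _ _)
    rcases this with rfl | rfl <;> simp [c.depth_apply] at hv
  rcases h with ⟨v, hv, rfl, rfl, -⟩ | ⟨i, hi, rfl, rfl, -⟩ <;>
    rcases h' with ⟨w, hw, h, rfl, -⟩ | ⟨k, hk, h, rfl, -⟩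
  · rcases Sym2.eq_iff.1 h with ⟨-, h⟩ | ⟨h, h'⟩
    · rw [h]
    · rw [← h, c.root_par v hv]
  · exact absurd h (key v k hv)
  · exact absurd h.symm (key w i hw)
  · rw [c.labelling.edge_injective hi hk h]

theorem vertexEdgeDist_le (h : c.HasPosition e x W) (s : V) :
    2 * vertexEdgeDist G s e + 1 ≤ 2 * c.depth s + (cycDist (2 * ℓ) (2 * c.root s) x + W) := by
  rcases h with ⟨v, hv, rfl, rfl, hW⟩ | ⟨i, hi, rfl, rfl, hW⟩
  · have := c.vertexEdgeDist_tree_le s hv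
    rw [cycDist_two_mul]
    omega
  · rw [c.vertexEdgeDist_cycle s hi, cycDist_two_mul_add_one (c.root_lt s) hi]
    omega

theorem vertexEdgeDist_eq (h : c.HasPosition e x W) {s : V} (hs : x ≠ 2 * c.root s) :
    2 * vertexEdgeDist G s e + 1 = 2 * c.depth s + (cycDist (2 * ℓ) (2 * c.root s) x + W) := by
  rcases h with ⟨v, hv, rfl, rfl, hW⟩ | ⟨i, hi, rfl, rfl, hW⟩
  · have := c.vertexEdgeDist_tree hv (u := s) (by omega)
    rw [cycDist_two_mul]
    omega
  · rw [c.vertexEdgeDist_cycle s hi, cycDist_two_mul_add_one (c.root_lt s) hi]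
    omega

end HasPosition

/-- The edge of a tree between its root and a child of the root without descendant `s`. -/
theorem vertexEdgeDist_of_not_desc {s v : V} (hv : c.depth v = 1) (hs : ¬ c.Desc v s) :
    2 * vertexEdgeDist G s s(c.par v, v) + 1 =
      2 * c.depth s + (cycDist (2 * ℓ) (2 * c.root s) (2 * c.root v) + 1) := by
  have h1 := c.dist_par_lt (by omega) hs
  have h2 : vertexEdgeDist G s s(c.par v, v) = min (G.dist s (c.par v)) (G.dist s v) := rfl
  have h3 := c.depth_par v (by omega)
  have h4 := c.dist_eq (u := s) (v := c.par v) (Or.inr (by omega))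
  rw [c.root_par v (by omega)] at h4
  rw [cycDist_two_mul]
  omega

/-- A branch-resolving set meeting two of the trees separates any two edges at the same position. -/
theorem isEdgeMetricGenerator_of_positions [Fintype V] [DecidableRel G.Adj] {S : Finset V}
    (hS : IsBranchResolving G S) (hroot : ∀ i, ∃ s ∈ S, c.root s ≠ i)
    (h : ∀ e f x y W W', c.HasPosition e x W → c.HasPosition f y W' → x < y →
      ∃ s ∈ S, vertexEdgeDist G s e ≠ vertexEdgeDist G s f) : IsEdgeMetricGenerator G S := by
  intro e he f hf hef
  obtain ⟨x, W, hx⟩ := exists_hasPosition (c := c) he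
  obtain ⟨y, W', hy⟩ := exists_hasPosition (c := c) hf
  rcases lt_trichotomy x y with hxy | hxy | hxy
  · exact h e f x y W W' hx hy hxy
  · by_contra! heq
    have hx' := hx
    have hy' := hy
    rcases hx with ⟨v, hv, rfl, rfl, hW⟩ | ⟨i, hi, rfl, rfl, rfl⟩ <;>
      rcases hy with ⟨w, hw, rfl, hxy', hW'⟩ | ⟨k, hk, rfl, hxy', rfl⟩
    -- An observer outside the tree reads off the weight, so the two edges have equal depth.
    · obtain ⟨s, hs, hsr⟩ := hroot (c.root v)
      have h1 := hx'.vertexEdgeDist_eq (s := s) (by omega)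
      have h2 := hy'.vertexEdgeDist_eq (s := s) (by omega)
      rw [← heq s hs, ← hxy] at h2
      have hd : c.depth v = c.depth w := by omega
      obtain ⟨u, u', hu, huu, hp, huv, huw, hn1, hn2⟩ :=
        c.exists_branching (by omega) hd (fun h => hef (by rw [h]))
      obtain ⟨t, ht, h | h⟩ := c.exists_desc_of_par_eq hS hu (by omega) hp
        (by rintro rfl; exact hn1 huw)
      · exact (c.vertexEdgeDist_lt_of_desc hu h huv hn1 hd).ne (heq t ht)
      · exact (c.vertexEdgeDist_lt_of_desc (by omega) h huw hn2 hd.symm).ne (heq t ht).symm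
    · omega
    · omega
    · obtain rfl : i = k := by omega
      exact hef rfl
  · obtain ⟨s, hs, h⟩ := h f e y x W' W hy hx hxy
    exact ⟨s, hs, h.symm⟩

theorem exists_ancestor (c : CycleCoords G ℓ a) {v : V} {d : ℕ} (hd : d ≤ c.depth v) :
    ∃ u, c.root u = c.root v ∧ c.depth u = d := by
  induction hn : c.depth v - d generalizing v with
  | zero => exact ⟨v, rfl, by omega⟩
  | succ n ih =>
    have hv : 0 < c.depth v := by omega
    have h1 := c.depth_par v hv
    obtain ⟨u, hu, hud⟩ := ih (v := c.par v) (by omega) (by omega)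
    exact ⟨u, by rw [hu, c.root_par v hv], hud⟩

variable [Fintype V]

theorem depth_lt_ncard_attachedTree (c : CycleCoords G ℓ a) (v : V) :
    c.depth v < (attachedTree G (a (c.root v))).ncard := by
  have h1 : Set.Iic (c.depth v) ⊆ c.depth '' attachedTree G (a (c.root v)) := by
    intro d hd
    obtain ⟨u, hu, rfl⟩ := c.exists_ancestor hd
    exact ⟨u, (c.mem_attachedTree _ (c.root_lt v) u).2 hu, rfl⟩
  have h2 := Set.ncard_le_ncard h1 (Set.toFinite _)
  have h3 := Set.ncard_image_le (f := c.depth) (Set.toFinite (attachedTree G (a (c.root v))))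
  rw [← Finset.coe_Iic, Set.ncard_coe_finset, Nat.card_Iic] at h2
  omega

/-- A tree missing `S` has at most one vertex of each depth, so its size is one more than its
height. This turns the lengths in (iii) and (iv) into edges of prescribed depth. -/
theorem exists_depth_eq [DecidableRel G.Adj] {S : Finset V} (hS : IsBranchResolving G S)
    {k d : ℕ} (hk : k < ℓ) (hSk : ∀ s ∈ S, c.root s ≠ k)
    (hd : d < (attachedTree G (a k)).ncard) : ∃ v, c.root v = k ∧ c.depth v = d := by
  by_contra! h
  have h1 : ∀ v, c.root v = k → c.depth v < d := by
    intro v hv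
    by_contra hvd
    obtain ⟨u, hu, hud⟩ := c.exists_ancestor (v := v) (d := d) (by omega)
    exact h u (hu.trans hv) hud
  have h2 : (attachedTree G (a k)).ncard ≤ (Finset.range d : Set ℕ).ncard := by
    refine Set.ncard_le_ncard_of_injOn c.depth ?_ ?_ (Finset.finite_toSet _)
    · intro v hv
      rw [c.mem_attachedTree k hk] at hv
      simpa using h1 v hv
    · intro v hv w hw hvw
      rw [c.mem_attachedTree k hk] at hv hw
      exact c.eq_of_forall_root_ne hS (by rwa [hv]) (by rw [hv, hw]) hvw
  rw [Set.ncard_coe_finset, Finset.card_range] at h2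
  omega

end CycleCoords

/-! ### Geodesic triples, and the two implications in coordinates. -/

namespace CycleCoords

variable {V : Type*} {G : SimpleGraph V} {ℓ : ℕ} {a : ℕ → V} {S : Finset V} {j : ℕ}

theorem mem_activeVertices (c : CycleCoords G ℓ a) (v : V) : v ∈ activeVertices G S ↔
    c.depth v = 0 ∧ ∃ s ∈ S, c.root s = c.root v := by
  rw [activeVertices, Set.mem_ofPred_eq, c.mem_cycleVertices]
  refine and_congr_right fun h => exists_congr fun s => and_congr_right fun _ => ?_
  rw [← c.mem_attachedTree _ (c.root_lt v), ← c.eq_of_depth_eq_zero v h]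

theorem apply_mem_activeVertices (c : CycleCoords G ℓ a) {i : ℕ} (hi : i < ℓ) :
    a i ∈ activeVertices G S ↔ ∃ s ∈ S, c.root s = i := by
  rw [c.mem_activeVertices, c.depth_apply, c.root_apply i hi]
  simp

/-- Three pairwise distances on a cycle add up to `ℓ` exactly when none of the three arcs exceeds
half of it; the last inequality concerns the arc through `0`. -/
theorem exists_isGeodesicTriple_iff (c : CycleCoords G ℓ a) :
    (∃ x ∈ activeVertices G S, ∃ y ∈ activeVertices G S, ∃ z ∈ activeVertices G S,
      IsGeodesicTriple G ℓ x y z) ↔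
    ∃ p q r : V, p ∈ S ∧ q ∈ S ∧ r ∈ S ∧ c.root p < c.root q ∧ c.root q < c.root r ∧
      2 * (c.root q - c.root p) ≤ ℓ ∧ 2 * (c.root r - c.root q) ≤ ℓ ∧
      ℓ ≤ 2 * (c.root r - c.root p) := by
  constructor
  · rintro ⟨x, hx, y, hy, z, hz, -, -, -, hxy, hyz, hxz, hsum⟩
    obtain ⟨hx0, p, hp, hpx⟩ := (c.mem_activeVertices x).1 hx
    obtain ⟨hy0, q, hq, hqy⟩ := (c.mem_activeVertices y).1 hy
    obtain ⟨hz0, r, hr, hrz⟩ := (c.mem_activeVertices z).1 hz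
    have hne : ∀ u v, c.depth u = 0 → c.depth v = 0 → u ≠ v → c.root u ≠ c.root v := by
      intro u v hu hv huv h
      rw [c.eq_of_depth_eq_zero u hu, c.eq_of_depth_eq_zero v hv, h] at huv
      exact huv rfl
    have h1 := hne x y hx0 hy0 hxy
    have h2 := hne y z hy0 hz0 hyz
    have h3 := hne x z hx0 hz0 hxz
    rw [c.dist_eq (Or.inr hy0), c.dist_eq (Or.inr hz0), c.dist_eq (Or.inr hx0), hx0, hy0, hz0,
      ← hpx, ← hqy, ← hrz] at hsum
    rw [← hpx, ← hqy] at h1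
    rw [← hqy, ← hrz] at h2
    rw [← hpx, ← hrz] at h3
    have key : ∀ p q r : V, p ∈ S → q ∈ S → r ∈ S → c.root p < c.root q → c.root q < c.root r →
        cycDist ℓ (c.root p) (c.root q) + cycDist ℓ (c.root q) (c.root r) +
          cycDist ℓ (c.root p) (c.root r) = ℓ →
        ∃ p q r : V, p ∈ S ∧ q ∈ S ∧ r ∈ S ∧ c.root p < c.root q ∧ c.root q < c.root r ∧
          2 * (c.root q - c.root p) ≤ ℓ ∧ 2 * (c.root r - c.root q) ≤ ℓ ∧
          ℓ ≤ 2 * (c.root r - c.root p) := by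
      intro p q r hp hq hr hpq hqr h
      have hrl := c.root_lt r
      refine ⟨p, q, r, hp, hq, hr, hpq, hqr, ?_⟩
      unfold cycDist at h
      omega
    have c1 := cycDist_comm ℓ (c.root p) (c.root q)
    have c2 := cycDist_comm ℓ (c.root q) (c.root r)
    have c3 := cycDist_comm ℓ (c.root p) (c.root r)
    rcases lt_or_gt_of_ne h1 with h1 | h1 <;> rcases lt_or_gt_of_ne h2 with h2 | h2 <;>
      rcases lt_or_gt_of_ne h3 with h3 | h3
    · exact key p q r hp hq hr h1 h2 (by omega)
    · omega
    · exact key p r q hp hr hq h3 h2 (by omega)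
    · exact key r p q hr hp hq h3 h1 (by omega)
    · exact key q p r hq hp hr h1 h3 (by omega)
    · exact key q r p hq hr hp h2 h3 (by omega)
    · omega
    · exact key r q p hr hq hp h2 h1 (by omega)
  · rintro ⟨p, q, r, hp, hq, hr, hpq, hqr, h1, h2, h3⟩
    have hp' := c.root_lt p
    have hq' := c.root_lt q
    have hr' := c.root_lt r
    have hc : ∀ i, a i ∈ cycleVertices G := fun i => (c.mem_cycleVertices _).2 (c.depth_apply i)
    refine ⟨a (c.root p), (c.apply_mem_activeVertices hp').2 ⟨p, hp, rfl⟩,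
      a (c.root q), (c.apply_mem_activeVertices hq').2 ⟨q, hq, rfl⟩,
      a (c.root r), (c.apply_mem_activeVertices hr').2 ⟨r, hr, rfl⟩, hc _, hc _, hc _,
      fun h => ?_, fun h => ?_, fun h => ?_, ?_⟩
    · have := c.labelling.eq_of_lt hp' hq' h
      omega
    · have := c.labelling.eq_of_lt hq' hr' h
      omega
    · have := c.labelling.eq_of_lt hp' hr' h
      omega
    · rw [c.dist_eq (Or.inr (c.depth_apply _)), c.dist_eq (Or.inr (c.depth_apply _)),
        c.dist_eq (Or.inr (c.depth_apply _)), c.depth_apply, c.depth_apply, c.depth_apply,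
        c.root_apply _ hp', c.root_apply _ hq', c.root_apply _ hr',
        cycDist_of_two_mul_le hpq.le h1, cycDist_of_two_mul_le hqr.le h2, cycDist_comm,
        cycDist_of_le_two_mul (hpq.trans hqr).le h3]
      omega

variable [Fintype V] [DecidableRel G.Adj]

theorem isEdgeMetricGenerator_of_triple (c : CycleCoords G ℓ a) (hS : IsBranchResolving G S)
    {p q r : V} (hp : p ∈ S) (hq : q ∈ S) (hr : r ∈ S) (hpq : c.root p < c.root q)
    (hqr : c.root q < c.root r) (h1 : 2 * (c.root q - c.root p) ≤ ℓ)
    (h2 : 2 * (c.root r - c.root q) ≤ ℓ) (h3 : ℓ ≤ 2 * (c.root r - c.root p)) :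
    IsEdgeMetricGenerator G S := by
  refine isEdgeMetricGenerator_of_positions (c := c) hS (fun i => ?_) ?_
  · by_cases h : c.root p = i
    · exact ⟨q, hq, by omega⟩
    · exact ⟨p, hp, h⟩
  · intro e f x y W W' hx hy hxy
    by_contra! heq
    have hr' := c.root_lt r
    have key : ∀ s ∈ S, ∃ D, D ≤ cycDist (2 * ℓ) (2 * c.root s) x + W ∧
        (x ≠ 2 * c.root s → D = cycDist (2 * ℓ) (2 * c.root s) x + W) ∧
        D ≤ cycDist (2 * ℓ) (2 * c.root s) y + W' ∧
        (y ≠ 2 * c.root s → D = cycDist (2 * ℓ) (2 * c.root s) y + W') := by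
      intro s hs
      have h1 := hx.vertexEdgeDist_le s
      have h2 := hy.vertexEdgeDist_le s
      have h3 := fun h => hx.vertexEdgeDist_eq (s := s) h
      have h4 := fun h => hy.vertexEdgeDist_eq (s := s) h
      rw [← heq s hs] at h2 h4
      -- Truncation is harmless: it preserves the upper bounds and does not occur when a distance
      -- formula is exact.
      exact ⟨2 * vertexEdgeDist G s e + 1 - 2 * c.depth s, by omega, by omega, by omega, by omega⟩
    obtain ⟨DP, p1, p2, p3, p4⟩ := key p hp
    obtain ⟨DQ, q1, q2, q3, q4⟩ := key q hq
    obtain ⟨DR, r1, r2, r3, r4⟩ := key r hr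
    exact hxy.ne (eq_of_cycDist_triple (by omega) (by omega) (by omega) (by omega) (by omega)
      (by omega) hx.lt hy.lt p1 p2 q1 q2 r1 r2 p3 p4 q3 q4 r3 r4)

/-- An edge in an active tree whose root is not bad is separated from the edges at all other
positions. -/
theorem HasPosition.exists_ne_of_not_isBadVertex {c : CycleCoords G ℓ a}
    (hS : S ∈ minBranchResolvingSets G) {A : ℕ} (hA : A < ℓ) (hbad : ¬ IsBadVertex G (a A))
    (hSA : ∃ s ∈ S, c.root s = A) (hSB : ∃ s ∈ S, c.root s ≠ A) {e f : Sym2 V} {x y W W' : ℕ}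
    (hx : c.HasPosition e x W) (hy : c.HasPosition f y W') (hxA : x = 2 * A) (hyA : y ≠ 2 * A) :
    ∃ s ∈ S, vertexEdgeDist G s e ≠ vertexEdgeDist G s f := by
  by_contra! heq
  obtain ⟨v, hv, rfl, hxv, hW⟩ | ⟨i, -, -, h, -⟩ := id hx
  swap
  · omega
  obtain rfl : c.root v = A := by omega
  obtain ⟨u, hu, hup, huv⟩ := (c.desc_root v).exists_child (by
    intro h
    rw [h, c.depth_apply] at hv
    omega)
  have hu1 := c.depth_par u hu
  rw [hup, c.depth_apply] at hu1
  obtain ⟨s, hs, hus⟩ := c.exists_desc_of_not_isBadVertex hS hu (by rw [hup, c.depth_apply])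
    (by rwa [hup]) (by rwa [hup, c.root_apply _ hA])
  have h1 := c.vertexEdgeDist_add_lt hu hus huv
  have hsr : c.root s = c.root v := by rw [hus.root_eq, huv.root_eq]
  obtain ⟨t, ht, htr⟩ := hSB
  have h2 := hy.vertexEdgeDist_eq (s := s) (by omega)
  have h3 := hx.vertexEdgeDist_eq (s := t) (by omega)
  have h4 := hy.vertexEdgeDist_le t
  rw [← heq s hs, hsr] at h2
  rw [← heq t ht] at h4
  have h5 := c.root_lt t
  -- The view from `t` gives `W ≤ cycDist (2 * ℓ) x y + W'`, while `s`, sharing a branch with `e`,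
  -- gives the strict reverse.
  have h6 := cycDist_triangle (L := 2 * ℓ) (i := 2 * c.root t) (k := x) (by omega) hx.lt hy.lt
  rw [hxv] at h6 h3
  omega

theorem isEdgeMetricGenerator_of_conditions (c : CycleCoords G ℓ a)
    (hS : S ∈ minBranchResolvingSets G) (h0 : ∃ s ∈ S, c.root s = 0)
    (hj : ∃ s ∈ S, c.root s = j) (hle : ∀ s ∈ S, c.root s ≤ j)
    (h : IsEdgeOddGraph G ℓ a j ∨ IsEdgeEvenGraph G ℓ a j) : IsEdgeMetricGenerator G S := by
  have hcom : EdgeCommonConditions G ℓ a j := h.elim (fun h => h.2.1) (fun h => h.2.1)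
  obtain ⟨hj1, hj2, ⟨hb0, hbj⟩, hii⟩ := hcom
  have hl := c.labelling.1
  obtain ⟨s0, hs0, hr0⟩ := id h0
  obtain ⟨sj, hsj, hrj⟩ := id hj
  -- This is (ii) in doubled coordinates: apart from the trees at `0` and `j`, nontrivial trees sit
  -- on the active arc or its antipode.
  have hfar : ∀ e x W, c.HasPosition e x W → x ≠ 2 * j →
      W = 0 ∨ x < 2 * j ∨ (ℓ ≤ x ∧ x ≤ ℓ + 2 * j) := by
    intro e x W hx hxj
    rcases hx with ⟨v, hv, -, rfl, -⟩ | ⟨-, -, -, -, h⟩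
    swap
    · exact Or.inl h
    right
    by_contra hcon
    have hvl := c.root_lt v
    have := hii (by omega) (c.root v) (by omega)
    have hm := (c.mem_attachedTree _ hvl v).2 rfl
    rw [this, Set.mem_singleton_iff] at hm
    rw [hm, c.depth_apply] at hv
    omega
  have hnb : ∀ k < ℓ, (∀ s ∈ S, c.root s ≠ k) → ∀ w ∈ attachedTree G (a k),
      ¬ IsBranchingVertex G w := by
    intro k hk hSk w hw
    rw [c.mem_attachedTree k hk] at hw
    rw [c.isBranchingVertex_iff]
    have := c.card_children_le_one_of_forall_root_ne hS.1 (v := w) (by rwa [hw])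
    omega
  refine isEdgeMetricGenerator_of_positions (c := c) hS.1 (fun i => ?_) ?_
  · by_cases h : i = 0
    · exact ⟨sj, hsj, by omega⟩
    · exact ⟨s0, hs0, by omega⟩
  · intro e f x y W W' hx hy hxy
    by_contra! heq
    have hends : ∀ A < ℓ, ¬ IsBadVertex G (a A) → (∃ s ∈ S, c.root s = A) →
        (∃ s ∈ S, c.root s ≠ A) → x ≠ 2 * A ∧ y ≠ 2 * A := by
      intro A hA hb h1 h2
      refine ⟨fun hxA => ?_, fun hyA => ?_⟩
      · obtain ⟨s, hs, hne⟩ :=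
          hx.exists_ne_of_not_isBadVertex hS hA hb h1 h2 hy hxA (by omega)
        exact hne (heq s hs)
      · obtain ⟨s, hs, hne⟩ :=
          hy.exists_ne_of_not_isBadVertex hS hA hb h1 h2 hx hyA (by omega)
        exact hne (heq s hs).symm
    obtain ⟨hx0, hy0⟩ := hends 0 (by omega) hb0 h0 ⟨sj, hsj, by omega⟩
    obtain ⟨hxj, hyj⟩ := hends j (by omega) hbj hj ⟨s0, hs0, by omega⟩
    have e1 := hx.vertexEdgeDist_eq (s := s0) (by omega)
    have e2 := hy.vertexEdgeDist_eq (s := s0) (by omega)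
    have e3 := hx.vertexEdgeDist_eq (s := sj) (by omega)
    have e4 := hy.vertexEdgeDist_eq (s := sj) (by omega)
    rw [← heq s0 hs0] at e2
    rw [← heq sj hsj] at e4
    rw [hr0] at e1 e2
    rw [hrj] at e3 e4
    obtain ⟨hxJ, hyℓ, hsum, hW⟩ := cycDist_pair (J := 2 * j) (W := W) (W' := W') (by omega)
      (by omega) (by omega) hxj hy.lt hyj hxy (hfar e x W hx hxj)
      (hfar f y W' hy hyj) (by rw [mul_zero] at e1 e2; omega) (by omega)
    by_cases hmid : ∃ s ∈ S, 0 < c.root s ∧ c.root s < j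
    · obtain ⟨s, hs, hs1, hs2⟩ := hmid
      have h1 := cycDist_lt_of_between (P := 2 * c.root s) (by omega) (by omega) (by omega)
        (by omega) hxJ hsum hW
      have h2 := hx.vertexEdgeDist_le s
      have h3 := hy.vertexEdgeDist_eq (s := s) (by omega)
      rw [← heq s hs] at h3
      omega
    · push Not at hmid
      have hin : ∀ k, 1 ≤ k → k ≤ j - 1 → ∀ s ∈ S, c.root s ≠ k := by
        intro k hk1 hk2 s hs hsk
        have := hmid s hs (by omega)
        omega
      -- A cycle edge at `x` would have `W = 0`, contradicting `W + 2 j = W' + ℓ` with `2 j < ℓ`. So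
      -- `e` lies in a tree, at depth beyond `(ℓ - 1) / 2 - j` for odd `ℓ`; for even `ℓ` the
      -- position `y` is even as well and both edges are tree edges.
      rcases hx with ⟨v, hv, rfl, rfl, hWv⟩ | ⟨i, hi, rfl, rfl, hWv⟩
      swap
      · omega
      have hdv := c.depth_lt_ncard_attachedTree v
      rcases h with ⟨hodd, -, hiii⟩ | ⟨heven, -, hiv⟩
      · have := hiii (by omega)
          (fun k hk1 hk2 => hnb k (by omega) (hin k hk1 hk2)) (c.root v) (by omega) (by omega)
        obtain ⟨m, hm⟩ := hodd
        rw [attachedTreeLength] at this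
        omega
      · obtain ⟨m, hm⟩ := heven
        rcases hy with ⟨w, hw, rfl, rfl, hWw⟩ | ⟨i, hi, rfl, rfl, hWw⟩
        swap
        · omega
        have hdw := c.depth_lt_ncard_attachedTree w
        have hrw : c.root w = ℓ / 2 + j - c.root v := by omega
        rw [hrw] at hdw
        have := hiv (by omega)
          (fun k hk1 hk2 => ⟨hnb k (by omega) (hin k hk1 hk2), hnb _ (by omega)
            (fun s hs => by have := hle s hs; omega)⟩) (c.root v) (by omega) (by omega)
          (by omega)
        rw [attachedTreeLength] at this
        omega

/-- Each condition that fails yields an explicit pair of edges with equal distances from all of `S`.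
-/
theorem conditions_of_isEdgeMetricGenerator (c : CycleCoords G ℓ a)
    (hS : S ∈ minBranchResolvingSets G) (h0 : ∃ s ∈ S, c.root s = 0)
    (hj : ∃ s ∈ S, c.root s = j) (hle : ∀ s ∈ S, c.root s ≤ j) (hj1 : 1 ≤ j) (hj2 : 2 * j ≤ ℓ)
    (hno : ¬ ∃ p q r : V, p ∈ S ∧ q ∈ S ∧ r ∈ S ∧ c.root p < c.root q ∧ c.root q < c.root r ∧
      2 * (c.root q - c.root p) ≤ ℓ ∧ 2 * (c.root r - c.root q) ≤ ℓ ∧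
      ℓ ≤ 2 * (c.root r - c.root p))
    (hgen : IsEdgeMetricGenerator G S) : IsEdgeOddGraph G ℓ a j ∨ IsEdgeEvenGraph G ℓ a j := by
  have hl := c.labelling.1
  have hsep : ∀ e f x y W W', c.HasPosition e x W → c.HasPosition f y W' → x ≠ y →
      ∃ s ∈ S, vertexEdgeDist G s e ≠ vertexEdgeDist G s f := by
    intro e f x y W W' hx hy hxy
    refine hgen e hx.mem_edgeSet f hy.mem_edgeSet ?_
    rintro rfl
    exact hxy (hx.unique hy)
  have hcyc : ∀ i < ℓ, ∀ s, 2 * vertexEdgeDist G s s(a i, a (i + 1)) + 1 =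
      2 * c.depth s + (cycDist (2 * ℓ) (2 * c.root s) (2 * i + 1) + 0) := fun i hi s =>
    (c.hasPosition_cycle hi).vertexEdgeDist_eq (by omega)
  -- Otherwise any further active vertex completes a triple, and the antipodal vertices `a 0` and `a
  -- j` alone cannot tell the two cycle edges at `a 0` apart.
  have hj3 : 2 * j ≠ ℓ := by
    intro h
    obtain ⟨s, hs, hne⟩ := hsep _ _ _ _ _ _ (c.hasPosition_cycle (i := 0) (by omega))
      (c.hasPosition_cycle (i := ℓ - 1) (by omega)) (by omega)
    have h1 := hcyc 0 (by omega) s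
    have h2 := hcyc (ℓ - 1) (by omega) s
    have h3 := hle s hs
    have h4 : c.root s = 0 ∨ c.root s = j := by
      by_contra! hcon
      obtain ⟨p, hp, hp0⟩ := h0
      obtain ⟨r, hr, hrj⟩ := hj
      exact hno ⟨p, s, r, hp, hs, hr, by omega, by omega, by omega, by omega, by omega⟩
    rcases h4 with h4 | h4 <;> rw [h4] at h1 h2 <;> unfold cycDist at h1 h2 <;> omega
  -- An edge from a cycle vertex to a child with nothing of `S` below it is as far from every `s` as
  -- that cycle vertex, so no cycle edge may be equally far from all indices up to `j`.
  have hpend : ∀ v i, c.depth v = 1 → (∀ s ∈ S, ¬ c.Desc v s) → i < ℓ →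
      (∀ r ≤ j, cycDist (2 * ℓ) (2 * r) (2 * c.root v) + 1 =
        cycDist (2 * ℓ) (2 * r) (2 * i + 1)) → False := by
    intro v i hv hvS hi heq
    obtain ⟨s, hs, hne⟩ := hsep _ _ _ _ _ _ (hasPosition_tree (c := c) (v := v) (by omega))
      (c.hasPosition_cycle hi) (by omega)
    have h1 := c.vertexEdgeDist_of_not_desc hv (hvS s hs)
    have h2 := hcyc i hi s
    have h3 := heq _ (hle s hs)
    omega
  have hbad : ∀ k i, k < ℓ → i < ℓ → (∀ r ≤ j, cycDist (2 * ℓ) (2 * r) (2 * k) + 1 =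
      cycDist (2 * ℓ) (2 * r) (2 * i + 1)) → ¬ IsBadVertex G (a k) := by
    intro k i hk hi heq hb
    obtain ⟨v, hv, hvp, hvS⟩ := c.exists_child_of_isBadVertex hS hb
    have h1 := c.depth_par v hv
    have h2 := c.root_par v hv
    rw [hvp, c.depth_apply] at h1
    rw [hvp, c.root_apply k hk] at h2
    exact hpend v i (by omega) hvS hi (by rwa [← h2])
  have htriv : ∀ k i, k < ℓ → i < ℓ → j < k → (∀ r ≤ j, cycDist (2 * ℓ) (2 * r) (2 * k) + 1 =
      cycDist (2 * ℓ) (2 * r) (2 * i + 1)) → attachedTree G (a k) = {a k} := by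
    intro k i hk hi hjk heq
    ext w
    rw [c.mem_attachedTree k hk, Set.mem_singleton_iff]
    constructor
    · intro hw
      by_contra hne
      have hd : 0 < c.depth w := by
        by_contra hd
        exact hne (by rw [c.eq_of_depth_eq_zero w (by omega), hw])
      obtain ⟨v, hvr, hvd⟩ := c.exists_ancestor (v := w) (d := 1) (by omega)
      refine hpend v i hvd (fun s hs h => ?_) hi (by rwa [hvr, hw])
      have := hle s hs
      rw [h.root_eq] at this
      omega
    · rintro rfl
      exact c.root_apply k hk
  have hin : ∀ k, k < ℓ → (∀ w ∈ attachedTree G (a k), ¬ IsBranchingVertex G w) →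
      ∀ s ∈ S, c.root s ≠ k := by
    intro k hk hbr s hs hsk
    obtain ⟨v, hv, hvs⟩ := c.exists_two_le_card_children hS hs
    exact hbr v ((c.mem_attachedTree k hk v).2 (by rw [← hvs.root_eq, hsk]))
      ((c.isBranchingVertex_iff v).2 hv)
  have hcom : EdgeCommonConditions G ℓ a j := by
    -- The partners are the cycle edges at `a 0` and `a j` that leave the arc from `0` to `j`.
    refine ⟨hj1, by omega, ⟨hbad 0 (ℓ - 1) (by omega) (by omega) ?_,
      hbad j j (by omega) (by omega) ?_⟩, fun hjlt k hk => ?_⟩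
    · intro r hr
      unfold cycDist
      omega
    · intro r hr
      unfold cycDist
      omega
    -- All of `S` reaches `a k` from the same side; the partner is the cycle edge on the other side
    -- of `a k`.
    · rcases hk with hk | hk
      · refine htriv k (k - 1) (by omega) (by omega) (by omega) fun r hr => ?_
        unfold cycDist
        omega
      · refine htriv k k (by omega) (by omega) (by omega) fun r hr => ?_
        unfold cycDist
        omega
  have hends : ∀ k, 1 ≤ k → k ≤ j - 1 →
      (∀ k, 1 ≤ k → k ≤ j - 1 → ∀ w ∈ attachedTree G (a k), ¬ IsBranchingVertex G w) →
      ∀ s ∈ S, c.root s = 0 ∨ c.root s = j := by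
    intro k hk1 hk2 hbr s hs
    have h1 := hle s hs
    by_contra! hcon
    exact hin (c.root s) (c.root_lt s) (hbr _ (by omega) (by omega)) s hs rfl
  rcases Nat.even_or_odd ℓ with heven | hodd
  · right
    refine ⟨heven, hcom, fun hj1' hbr k hk1 hk2 hk' => ?_⟩
    have hends' := hends k hk1 hk2 (fun k hk1 hk2 => (hbr k hk1 hk2).1)
    obtain ⟨m, hm⟩ := heven
    by_contra hlen
    rw [attachedTreeLength] at hlen
    -- The mirror tree contributes an edge of depth `1`, and weights must differ by `ℓ - 2 j`; this
    -- fixes the depth `ℓ / 2 - j + 1` in the tree at `k`.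
    obtain ⟨v, hvr, hvd⟩ := c.exists_depth_eq hS.1 (k := k) (d := ℓ / 2 - j + 1) (by omega)
      (hin k (by omega) (hbr k hk1 hk2).1) (by omega)
    obtain ⟨u, hur, hud⟩ := c.exists_depth_eq hS.1 (k := ℓ / 2 + j - k) (d := 1) (by omega)
      (hin _ (by omega) (hbr k hk1 hk2).2) hk'
    have hpv := hasPosition_tree (c := c) (v := v) (by omega)
    have hpu := hasPosition_tree (c := c) (v := u) (by omega)
    obtain ⟨s, hs, hne⟩ := hsep _ _ _ _ _ _ hpv hpu (by omega)
    have hs' := hends' s hs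
    have h1 := hpv.vertexEdgeDist_eq (s := s) (by omega)
    have h2 := hpu.vertexEdgeDist_eq (s := s) (by omega)
    rw [hvr] at h1
    rw [hur] at h2
    rcases hs' with hs' | hs' <;> rw [hs'] at h1 h2 <;> unfold cycDist at h1 h2 <;> omega
  · left
    refine ⟨hodd, hcom, fun hj1' hbr k hk1 hk2 => ?_⟩
    have hends' := hends k hk1 hk2 hbr
    obtain ⟨m, hm⟩ := hodd
    by_contra hlen
    rw [attachedTreeLength] at hlen
    -- The mirror of position `2 k` is the odd position `2 (m + j - k) + 1`, a cycle edge of weight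
    -- `0`, so here the weight has to be `ℓ - 2 j`.
    obtain ⟨v, hvr, hvd⟩ := c.exists_depth_eq hS.1 (k := k) (d := (ℓ - 1) / 2 - j + 1) (by omega)
      (hin k (by omega) (hbr k hk1 hk2)) (by omega)
    have hpv := hasPosition_tree (c := c) (v := v) (by omega)
    obtain ⟨s, hs, hne⟩ := hsep _ _ _ _ _ _ hpv
      (c.hasPosition_cycle (i := m + j - k) (by omega)) (by omega)
    have hs' := hends' s hs
    have h1 := hpv.vertexEdgeDist_eq (s := s) (by omega)
    have h2 := hcyc (m + j - k) (by omega) s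
    rw [hvr] at h1
    rcases hs' with hs' | hs' <;> rw [hs'] at h1 h2 <;> unfold cycDist at h1 h2 <;> omega

end CycleCoords

/-! ### Normal labellings and the conclusion. -/

theorem IsCycleLabelling.shift {V : Type*} {G : SimpleGraph V} {ℓ : ℕ} {a : ℕ → V}
    (ha : IsCycleLabelling G ℓ a) (n : ℕ) : IsCycleLabelling G ℓ fun i => a (i + n) := by
  refine ⟨ha.1, fun i => ?_, fun i => ?_, fun i hi k hk h => ?_⟩
  · have := ha.2.1 (i + n)
    rwa [show i + n + 1 = i + 1 + n by omega] at this
  · change a (i + ℓ + n) = a (i + n)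
    rw [show i + ℓ + n = i + n + ℓ by omega, ha.2.2.1]
  · have h1 := (ha.apply_eq_iff _ _).1 h
    have h2 : i ≡ k [MOD ℓ] := Nat.ModEq.add_right_cancel' n h1
    exact Nat.ModEq.eq_of_lt_of_lt h2 hi hk

/-- In a normal labelling, a gap between consecutive active indices is at most the last gap. -/
theorem IsNormalLabelling.gap_le {V : Type*} {G : SimpleGraph V} {S : Finset V} {ℓ : ℕ}
    {a : ℕ → V} (ha : IsNormalLabelling G S ℓ a) {j x y : ℕ} (hj : IsLastActiveIndex G S ℓ a j)
    (hx : a x ∈ activeVertices G S) (hy : a y ∈ activeVertices G S) (hxy : x < y) (hyℓ : y < ℓ)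
    (hgap : ∀ i < ℓ, a i ∈ activeVertices G S → i ≤ x ∨ y ≤ i) : j + y ≤ x + ℓ := by
  have h1 := ha.2.2 (fun i => a (i + y)) (ha.1.shift y) (by simpa using hy) j (x + ℓ - y) hj ?_
  · omega
  · constructor
    · refine ⟨by omega, ?_⟩
      simp only
      rwa [show x + ℓ - y + y = x + ℓ by omega, ha.1.2.2.1]
    · rintro i ⟨hi, hiS⟩
      simp only at hiS
      rcases Nat.lt_or_ge (i + y) ℓ with h | h
      · omega
      · rw [show i + y = i + y - ℓ + ℓ by omega, ha.1.2.2.1] at hiS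
        have := hgap (i + y - ℓ) (by omega) hiS
        omega

theorem theorem2 {V : Type*} [Fintype V] (G : SimpleGraph V) [DecidableRel G.Adj]
    (hG : IsUnicyclic G) (S : Finset V) (hS : S ∈ minBranchResolvingSets G)
    (hA : 2 ≤ (activeVertices G S).ncard)
    (ℓ : ℕ) (a : ℕ → V) (ha : IsNormalLabelling G S ℓ a)
    (j : ℕ) (hj : IsLastActiveIndex G S ℓ a j) :
    IsEdgeMetricGenerator G S ↔
      (∃ x ∈ activeVertices G S, ∃ y ∈ activeVertices G S, ∃ z ∈ activeVertices G S,
        IsGeodesicTriple G ℓ x y z) ∨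
      IsEdgeOddGraph G ℓ a j ∨ IsEdgeEvenGraph G ℓ a j := by
  classical
  obtain ⟨c⟩ := ha.1.exists_cycleCoords hG
  have hl := ha.1.1
  have h0 : ∃ s ∈ S, c.root s = 0 := (c.apply_mem_activeVertices (by omega)).1 ha.2.1
  have hjS : ∃ s ∈ S, c.root s = j := (c.apply_mem_activeVertices hj.1.1).1 hj.1.2
  have hle : ∀ s ∈ S, c.root s ≤ j := fun s hs =>
    hj.2 ⟨c.root_lt s, (c.apply_mem_activeVertices (c.root_lt s)).2 ⟨s, hs, rfl⟩⟩
  rw [c.exists_isGeodesicTriple_iff]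
  constructor
  · intro hgen
    by_cases htri : ∃ p q r : V, p ∈ S ∧ q ∈ S ∧ r ∈ S ∧ c.root p < c.root q ∧
        c.root q < c.root r ∧ 2 * (c.root q - c.root p) ≤ ℓ ∧
        2 * (c.root r - c.root q) ≤ ℓ ∧ ℓ ≤ 2 * (c.root r - c.root p)
    · exact Or.inl htri
    · right
      refine c.conditions_of_isEdgeMetricGenerator hS h0 hjS hle ?_ ?_ htri hgen
      · by_contra hj0
        have hsub : activeVertices G S ⊆ {a 0} := by
          intro v hv
          obtain ⟨hv0, s, hs, hsv⟩ := (c.mem_activeVertices v).1 hv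
          have := hle s hs
          rw [Set.mem_singleton_iff, c.eq_of_depth_eq_zero v hv0, show c.root v = 0 by omega]
        have := Set.ncard_le_ncard hsub (Set.toFinite _)
        rw [Set.ncard_singleton] at this
        omega
      · by_contra hj2
        obtain ⟨s0, hs0, hr0⟩ := h0
        obtain ⟨sj, hsj, hrj⟩ := hjS
        -- If `2 j > ℓ`, take the active indices `p` and `q` on either side of `ℓ / 2`. By normality
        -- their gap is at most the last gap `ℓ - j`, hence less than half the cycle, so `0`, `p`,
        -- `q` give a geodesic triple.
        obtain ⟨p, hp, hpmax⟩ := Finset.exists_max_image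
          (S.filter fun s => 2 * c.root s ≤ ℓ) c.root ⟨s0, by simp [hs0, hr0]⟩
        obtain ⟨q, hq, hqmin⟩ := Finset.exists_min_image
          (S.filter fun s => ℓ < 2 * c.root s) c.root ⟨sj, by simp [hsj]; omega⟩
        simp only [Finset.mem_filter] at hp hq hpmax hqmin
        have hgap := ha.gap_le hj (x := c.root p) (y := c.root q)
          ((c.apply_mem_activeVertices (c.root_lt p)).2 ⟨p, hp.1, rfl⟩)
          ((c.apply_mem_activeVertices (c.root_lt q)).2 ⟨q, hq.1, rfl⟩) (by omega) (c.root_lt q)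
          (fun i hi hiS => by
            obtain ⟨s, hs, rfl⟩ := (c.apply_mem_activeVertices hi).1 hiS
            rcases le_or_gt (2 * c.root s) ℓ with h | h
            · exact Or.inl (hpmax s ⟨hs, h⟩)
            · exact Or.inr (hqmin s ⟨hs, h⟩))
        have hqj := hle q hq.1
        exact htri ⟨s0, p, q, hs0, hp.1, hq.1, by omega, by omega, by omega, by omega, by omega⟩
  · rintro (⟨p, q, r, hp, hq, hr, hpq, hqr, h1, h2, h3⟩ | h)
    · exact c.isEdgeMetricGenerator_of_triple hS.1 hp hq hr hpq hqr h1 h2 h3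
    · exact c.isEdgeMetricGenerator_of_conditions hS h0 hjS hle h
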